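/- Let $n\ge 2$ be an integer, let $S$ and $B$ be the unit sphere and the open unit ball of $\mathbb C^n$, and let $(z|w)=\sum_{j=1}^n z_j\overline{w_j}$. Let $\mathcal H^{(p,q)}$ be the space of polynomials $P(z,\bar z)$ on $\mathbb C^n$ that are harmonic, $4\sum_j \partial^2P/\partial z_j\partial\bar z_j=0$, and bihomogeneous of bidegree $(p,q)$, i.e. $P(\lambda z,\bar\lambda\bar z)=\lambda^p\bar\lambda^q P(z,\bar z)$ for all $\lambda\in\mathbb C$. Write $(a)_k=a(a+1)\cdots(a+k-1)$, $(a)_0=1$, and for $\xi,\eta\in S$ let $$Z^{(p,q)}_\eta(\xi)=\frac{(n-1)_{p+q}}{(n-1)_p(n-1)_q}\,(\xi|\eta)^p\,\overline{(\xi|\eta)}^{\,q}\;{}_2F_1\!\left(-p,-q;\,2-n-p-q;\,|(\xi|\eta)|^{-2}\right),$$ where the ${}_2F_1$ denotes the terminating sum over $0\le i\le\min(p,q)$, so that the right-hand side is a polynomial in $(\xi|\eta)$ and $\overline{(\xi|\eta)}$; it is read as this polynomial also when $(\xi|\eta)=0$. Let $$P_n(z,\eta)=\frac{(1-|z|^2)^n}{|1-(z|\eta)|^{2n}},\qquad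 z\in B,\ \eta\in S,$$ be the Poisson–Szegő kernel. Theorem. Let $0\le r<1$ and $\eta\in S$. Each $Z^{(p,q)}_\eta$ is the restriction to $S$ of an element of $\mathcal H^{(p,q)}$, and the spherical harmonic expansion of $\xi\mapsto P_n(r\xi,\eta)$ is $$P_n(r\xi,\eta)=\frac{(1-r^2)^n}{|1-r(\xi|\eta)|^{2n}}=\sum_{p,q=0}^\infty \dim\mathcal H^{(p,q)}\;S_n^{p,q}(r)\;Z^{(p,q)}_\eta(\xi),\qquad \xi\in S,$$ with absolute and uniform convergence on $S$, where $S_n^{p,q}(r)$ is the sum of the convergent series $$S_n^{p,q}(r)=r^{p+q}\,\frac{(p+n-1)!\,(q+n-1)!}{(n-1)!}\sum_{k=0}^\infty\frac{(p)_k\,(q)_k}{(n-1+p+q+k)!}\,\frac{r^{2k}}{k!}.$$ For $p,q\ge1$ this is $$S_n^{p,q}(r)=r^{p+q}\,\frac{(p+n-1)!\,(q+n-1)!}{(n-1)!\,(p-1)!\,(q-1)!}\sum_{k=0}^\infty\frac{(p+k-1)!\,(q+k-1)!}{(n-1+p+q+k)!}\,\frac{r^{2k}}{k!},$$ and for all $p,q\ge0$,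 equivalently, $$S_n^{p,q}(r)=r^{p+q}\;\frac{{}_2F_1(p,q;p+q+n;r^2)}{{}_2F_1(p,q;p+q+n;1)},$$ where the series ${}_2F_1(p,q;p+q+n;1)$ in the denominator converges and is positive. -/

import Mathlib

noncomputable section

namespace ComplexSphere

/-- The hermitian inner product `(z|w) = ∑ j, z_j * conj w_j` on `ℂⁿ`, linear in the first
argument. -/
def herm {n : ℕ} (z w : EuclideanSpace ℂ (Fin n)) : ℂ :=
  ∑ j, z j * starRingEnd ℂ (w j)

/-- Polynomials `P(z, z̄)` on `ℂⁿ`: the variable `Sum.inl j` stands for `z_j` and the variable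
`Sum.inr j` for the conjugate of `z_j`. -/
abbrev ConjPolynomial (n : ℕ) : Type := MvPolynomial (Fin n ⊕ Fin n) ℂ

/-- The value `P(z, z̄)` at the point `z`. -/
def ConjPolynomial.value {n : ℕ} (P : ConjPolynomial n) (z : EuclideanSpace ℂ (Fin n)) : ℂ :=
  MvPolynomial.eval (Sum.elim (fun j => z j) (fun j => starRingEnd ℂ (z j))) P

/-- Bihomogeneous polynomials of bidegree `(p, q)`:
`P(l z, l̄ z̄) = l ^ p * l̄ ^ q * P(z, z̄)` for all `l ∈ ℂ`, `z ∈ ℂⁿ`. -/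
def bihomogeneous (n p q : ℕ) : Submodule ℂ (ConjPolynomial n) where
  carrier := {P | ∀ (l : ℂ) (z : EuclideanSpace ℂ (Fin n)),
    P.value (l • z) = l ^ p * (starRingEnd ℂ l) ^ q * P.value z}
  zero_mem' := by
    intro l z
    simp [ConjPolynomial.value]
  add_mem' := by
    intro P Q hP hQ l z
    have h1 := hP l z
    have h2 := hQ l z
    simp only [ConjPolynomial.value, map_add] at h1 h2 ⊢
    rw [h1, h2]
    ring
  smul_mem' := by
    intro c P hP l z
    have h1 := hP l z
    simp only [ConjPolynomial.value, MvPolynomial.smul_eval] at h1 ⊢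
    rw [h1]
    ring

/-- The Euclidean Laplacian of `ℂⁿ = ℝ²ⁿ` in complex coordinates, `4 ∑ j, ∂² / ∂z_j ∂z̄_j`. -/
def laplacian (n : ℕ) : ConjPolynomial n →ₗ[ℂ] ConjPolynomial n :=
  (4 : ℂ) • ∑ j : Fin n,
    (MvPolynomial.pderiv (R := ℂ) (Sum.inl j : Fin n ⊕ Fin n)).toLinearMap ∘ₗ
      (MvPolynomial.pderiv (R := ℂ) (Sum.inr j : Fin n ⊕ Fin n)).toLinearMap

/-- The space `𝓗^(p,q)` of solid harmonics: harmonic bihomogeneous polynomials on `ℂⁿ` of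
bidegree `(p, q)`. -/
def solidHarmonics (n p q : ℕ) : Submodule ℂ (ConjPolynomial n) :=
  LinearMap.ker (laplacian n) ⊓ bihomogeneous n p q

/-- The Pochhammer symbol `(a)_k = a (a + 1) ⋯ (a + k - 1)`, with `(a)_0 = 1`. -/
def poch (a : ℝ) (k : ℕ) : ℝ := (ascPochhammer ℝ k).eval a

/-- The disc polynomial
`W_{p,q}^α(w) = (α+1)_{p+q} / ((α+1)_p (α+1)_q) w^p w̄^q ₂F₁(-p, -q; -α-p-q; 1 / |w|²)`,
normalised to be `1` at `w = 1`. The hypergeometric series has only the terms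
`i ≤ min p q`, and `w^p w̄^q |w|^(-2i) = w^(p-i) w̄^(q-i)`, so that `w = 0` is allowed. -/
def discPolynomial (α : ℝ) (p q : ℕ) (w : ℂ) : ℂ :=
  ((poch (α + 1) (p + q) / (poch (α + 1) p * poch (α + 1) q) : ℝ) : ℂ) *
    ∑ i ∈ Finset.range (min p q + 1),
      ((poch (-p) i * poch (-q) i / (poch (-α - p - q) i * (i.factorial : ℝ)) : ℝ) : ℂ) *
        w ^ (p - i) * (starRingEnd ℂ w) ^ (q - i)

/-- The zonal kernel `Z_η^(p,q)(ξ)`. -/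
def zonalKernel {n : ℕ} (p q : ℕ) (η ξ : EuclideanSpace ℂ (Fin n)) : ℂ :=
  discPolynomial ((n : ℝ) - 2) p q (herm ξ η)

/-- The Poisson–Szegő kernel `P_n(z, η) = (1 - |z|²)^n / |1 - (z|η)|^(2n)` of the unit ball. -/
def poissonSzego {n : ℕ} (z η : EuclideanSpace ℂ (Fin n)) : ℝ :=
  (1 - ‖z‖ ^ 2) ^ n / ‖1 - herm z η‖ ^ (2 * n)

/-- The `k`-th term of the series `S_n^{p,q}(r)`, including the prefactor. The quotients
`(p+k-1)! / (p-1)!` and `(q+k-1)! / (q-1)!` are written as the Pochhammer symbols `(p)_k` and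
`(q)_k`, which also make sense when `p = 0` or `q = 0`. -/
def szegoTerm (n p q : ℕ) (r : ℝ) (k : ℕ) : ℝ :=
  r ^ (p + q) * (((p + n - 1).factorial * (q + n - 1).factorial : ℝ) / (n - 1).factorial) *
    (poch p k * poch q k / (n - 1 + p + q + k).factorial * (r ^ (2 * k) / k.factorial))

/-- The coefficient `S_n^{p,q}(r)`. -/
def szegoCoeff (n p q : ℕ) (r : ℝ) : ℝ := ∑' k, szegoTerm n p q r k

end ComplexSphere

end

/-! ### Pochhammer symbols and hypergeometric summation formulas -/

namespace ComplexSphere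

open Finset Filter Topology

/-! Write `w = (ξ|η)`. The kernel is `(1 - r²)^n (1 - r w)^(-n) (1 - r w̄)^(-n)`, so binomial series
expand it into an absolutely convergent triple series in `r^(a+b+2m) w^a w̄^b`. The claimed
expansion is a triple series over `p, q` and the index `k` of `S_n^{p,q}`. Both are regrouped by the
exponents `u, v`, where `(u, v)` is `(a+m, b+m)` in one and `(p+k, q+k)` in the other. Each group is
finite, and expanding the disc polynomials inside it reduces the claim to one identity for each `a,
b, m`, with `p = a+i`, `q = b+i`, `k = m-i`. After inserting the dimension of the harmonic space
this is the terminating very well poised `₅F₄` sum (`sum_range_wellPoised`, `sum_fiber_eq`).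

The regrouping needs absolute convergence, and uniform convergence needs a bound independent of `ξ`.
Three estimates give it: `|Z| ≤ 1` on the sphere, because `Z` is a reproducing kernel for the
Fischer inner product with diagonal value `1` (`norm_zonalKernel_le_one`); `0 ≤ S_n^{p,q}(r) ≤
r^(p+q)`, by Gauss' theorem (`szegoCoeff_le`); and the dimension is at most that of all
bihomogeneous polynomials. The exact dimension follows from surjectivity of the Laplacian between
bihomogeneous spaces (`map_laplacian_bihomogeneous`). -/

theorem poch_zero (a : ℝ) : poch a 0 = 1 := by simp [poch]

theorem poch_succ (a : ℝ) (k : ℕ) : poch a (k + 1) = poch a k * (a + k) := by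
  simp [poch, ascPochhammer_succ_eval]

theorem poch_succ_left (a : ℝ) (k : ℕ) : poch a (k + 1) = a * poch (a + 1) k := by
  simp [poch, ascPochhammer_succ_left, Polynomial.eval_comp]

theorem poch_pos {a : ℝ} (ha : 0 < a) (k : ℕ) : 0 < poch a k := ascPochhammer_pos k a ha

theorem poch_nonneg {a : ℝ} (ha : 0 ≤ a) (k : ℕ) : 0 ≤ poch a k := by
  induction k with
  | zero => simp [poch_zero]
  | succ k ih => rw [poch_succ]; positivity

theorem factorial_mul_poch (m k : ℕ) : (m.factorial : ℝ) * poch (m + 1) k = (m + k).factorial := by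
  induction k with
  | zero => simp [poch_zero]
  | succ k ih =>
    rw [poch_succ, ← mul_assoc, ih, ← add_assoc, Nat.factorial_succ]
    push_cast
    ring

theorem poch_neg_natCast (m k : ℕ) : poch (-(m : ℝ)) k = (-1) ^ k * m.descFactorial k := by
  induction k with
  | zero => simp [poch_zero]
  | succ k ih =>
    rw [poch_succ, ih, Nat.descFactorial_succ]
    rcases le_or_gt k m with h | h
    · push_cast [Nat.cast_sub h]; ring
    · simp [Nat.descFactorial_of_lt h]

/-- The telescoping sum behind the summation formula for the terminating very well poised
`₅F₄`. -/
theorem sum_range_wellPoised_telescope (a b n : ℝ) (h : 0 < a + b + n - 1) (j l : ℕ) :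
    ∑ i ∈ range (j + 1),
      ((j + l + 1 : ℝ) * ((-1) ^ i * (a + b + n - 1 + 2 * i) * poch (a + n) i * poch (b + n) i *
          poch (a + i) (j + l + 1 - i) * poch (b + i) (j + l + 1 - i) /
          (i.factorial * (j + l + 1 - i).factorial * poch (a + b + n - 1 + i) (j + l + 2))) +
        (n - (j + l)) * ((-1) ^ i * (a + b + n - 1 + 2 * i) * poch (a + n) i * poch (b + n) i *
          poch (a + i) (j + l - i) * poch (b + i) (j + l - i) /
          (i.factorial * (j + l - i).factorial * poch (a + b + n - 1 + i) (j + l + 1)))) =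
      (-1) ^ j * poch (a + n) (j + 1) * poch (b + n) (j + 1) * poch (a + j) l * poch (b + j) l /
        (j.factorial * l.factorial * poch (a + b + n + j) (j + l + 1)) := by
  -- With `m = j + l`, the summand is `(m+1) F(m+1, i) + (n-m) F(m, i)`, where `F(m, i)` is the
  -- `₅F₄` term. The induction moves the cut-off `j` at fixed `m`, hence uses the hypothesis at `l +
  -- 1`.
  induction j generalizing l with
  | zero =>
    have h1 : 0 < poch (a + b + n) l := poch_pos (by linarith) l
    have h2 : 0 < a + b + n + l := by linarith [(Nat.cast_nonneg l : (0 : ℝ) ≤ l)]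
    have hl : (l.factorial : ℝ) ≠ 0 := by positivity
    have e1 : poch (a + b + n - 1) (l + 2) =
        (a + b + n - 1) * (poch (a + b + n) l * (a + b + n + l)) := by
      rw [poch_succ_left, poch_succ]; ring_nf
    have e2 : poch (a + b + n - 1) (l + 1) = (a + b + n - 1) * poch (a + b + n) l := by
      rw [poch_succ_left]; ring_nf
    simp only [zero_add, range_one, sum_singleton, Nat.cast_zero, add_zero, tsub_zero, poch_zero,
      mul_zero, pow_zero, e1, e2, poch_succ a l, poch_succ b l, poch_succ (a + b + n) l, 
      poch_succ (a + n) 0, poch_succ (b + n) 0, Nat.factorial_succ l, Nat.factorial_zero]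
    push_cast
    generalize poch (a + b + n) l = D at *
    field_simp
    ring
  | succ j ih =>
    have hx : 0 < a + b + n + j := by linarith [(Nat.cast_nonneg j : (0 : ℝ) ≤ j)]
    have hy : 0 < a + b + n + j + 1 + (j + l + 1) := by
      linarith [(Nat.cast_nonneg j : (0 : ℝ) ≤ j), (Nat.cast_nonneg l : (0 : ℝ) ≤ l)]
    have hD : 0 < poch (a + b + n + j + 1) (j + l + 1) := poch_pos (by linarith) _
    have hl : (l.factorial : ℝ) ≠ 0 := by positivity
    have hj : (j.factorial : ℝ) ≠ 0 := by positivity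
    rw [sum_range_succ]
    have ih' := ih (l + 1)
    have c1 : j + (l + 1) + 1 = j + 1 + l + 1 := by ring
    have c2 : j + (l + 1) = j + 1 + l := by ring
    have c4 : (j : ℝ) + ((l + 1 : ℕ) : ℝ) = ((j + 1 : ℕ) : ℝ) + l := by push_cast; ring
    rw [c1, c2, c4] at ih'
    rw [ih']
    have d1 : j + 1 + l + 1 - (j + 1) = l + 1 := by omega
    have d2 : j + 1 + l - (j + 1) = l := by omega
    rw [d1, d2]
    have e0 : poch (a + b + n - 1 + (j + 1 : ℕ)) (j + 1 + l + 1) =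
        (a + b + n + j) * poch (a + b + n + j + 1) (j + l + 1) := by
      rw [poch_succ_left, add_right_comm j 1 l]; push_cast; ring_nf
    have e1 : poch (a + b + n - 1 + (j + 1 : ℕ)) (j + 1 + l + 2) =
        (a + b + n + j) * poch (a + b + n + j + 1) (j + l + 1) *
          (a + b + n + j + 1 + (j + l + 1)) := by
      rw [poch_succ, e0]; push_cast; ring
    have e2 : poch (a + b + n + j) (j + 1 + l + 1) =
        (a + b + n + j) * poch (a + b + n + j + 1) (j + l + 1) := by
      rw [poch_succ_left, add_right_comm j 1 l]
    have e3 : poch (a + b + n + (j + 1 : ℕ)) (j + 1 + l + 1) =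
        poch (a + b + n + j + 1) (j + l + 1) * (a + b + n + j + 1 + (j + l + 1)) := by
      rw [poch_succ, add_right_comm j 1 l]; push_cast; ring_nf
    have e4 : poch (a + j) (l + 1) = (a + j) * poch (a + (j + 1 : ℕ)) l := by
      rw [poch_succ_left]; push_cast; ring_nf
    have e5 : poch (b + j) (l + 1) = (b + j) * poch (b + (j + 1 : ℕ)) l := by
      rw [poch_succ_left]; push_cast; ring_nf
    rw [e0, e1, e2, e3, e4, e5, poch_succ _ l, poch_succ _ l, poch_succ _ (j + 1),
      poch_succ _ (j + 1), Nat.factorial_succ j, Nat.factorial_succ l, pow_succ]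
    generalize poch (a + n) (j + 1) = P
    generalize poch (b + n) (j + 1) = Q
    generalize poch (a + (j + 1 : ℕ)) l = R
    generalize poch (b + (j + 1 : ℕ)) l = S
    generalize poch (a + b + n + j + 1) (j + l + 1) = D at *
    push_cast
    field_simp
    ring

/-- Summation of the terminating very well poised `₅F₄`. -/
theorem sum_range_wellPoised (a b n : ℝ) (h : 0 < a + b + n - 1) (m : ℕ) :
    ∑ i ∈ range (m + 1), (-1) ^ i * (a + b + n - 1 + 2 * i) * poch (a + n) i * poch (b + n) i *
        poch (a + i) (m - i) * poch (b + i) (m - i) /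
        (i.factorial * (m - i).factorial * poch (a + b + n - 1 + i) (m + 1)) =
      poch (-n) m / m.factorial := by
  induction m with
  | zero =>
    simp [poch_zero, poch_succ, h.ne']
  | succ m ih =>
    -- At `l = 0` the cut-off reaches `i = m`, missing only the last term of the sum for `m + 1`.
    -- That term cancels the telescoped value (`hG`), leaving the first-order recurrence that
    -- `(-n)_m / m!` satisfies (`hR`).
    have hT := sum_range_wellPoised_telescope a b n h m 0
    simp only [Nat.cast_zero, add_zero, poch_zero, Nat.factorial_zero, Nat.cast_one, mul_one,
      sum_add_distrib, ← mul_sum] at hT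
    rw [ih] at hT
    rw [sum_range_succ, Nat.sub_self, poch_zero, poch_zero]
    have hD : 0 < poch (a + b + n + m) (m + 1) :=
      poch_pos (by linarith [(Nat.cast_nonneg m : (0 : ℝ) ≤ m)]) _
    have hy : 0 < a + b + n + m + (m + 1) := by linarith [(Nat.cast_nonneg m : (0 : ℝ) ≤ m)]
    have e1 : poch (a + b + n - 1 + (m + 1 : ℕ)) (m + 1 + 1) =
        poch (a + b + n + m) (m + 1) * (a + b + n + m + (m + 1)) := by
      rw [poch_succ]; push_cast; ring_nf
    have hm : (m.factorial : ℝ) ≠ 0 := by positivity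
    have hm1 : (m : ℝ) + 1 ≠ 0 := by positivity
    have hR : ((m : ℝ) + 1) * (poch (-n) (m + 1) / (m + 1).factorial) =
        -((n - m) * (poch (-n) m / m.factorial)) := by
      rw [poch_succ, Nat.factorial_succ]
      push_cast
      field_simp
      ring
    have hG : ((m : ℝ) + 1) * ((-1) ^ (m + 1) * (a + b + n - 1 + 2 * (m + 1 : ℕ)) *
        poch (a + n) (m + 1) * poch (b + n) (m + 1) * 1 * 1 / ((m + 1).factorial *
          (0).factorial * poch (a + b + n - 1 + (m + 1 : ℕ)) (m + 1 + 1))) =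
        -((-1) ^ m * poch (a + n) (m + 1) * poch (b + n) (m + 1) /
          (m.factorial * poch (a + b + n + m) (m + 1))) := by
      rw [e1, Nat.factorial_succ, Nat.factorial_zero]
      push_cast
      field_simp
      ring
    apply mul_left_cancel₀ hm1
    rw [mul_add, hR, hG, ← hT]
    ring

/-- Chu–Vandermonde with cleared denominators, used to evaluate the disc polynomial at `1`. Pascal's
rule splits the sum into its instances at `(q, N + 1)` and `(q - 1, N + 1)`. -/
theorem sum_range_choose_mul_descFactorial_mul_factorial (p q N : ℕ) :
    ∑ i ∈ range (p + 1), (p.choose i : ℝ) *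
        ((-1) ^ i * q.descFactorial i * (N + q + (p - i)).factorial) =
      (N + p).factorial * (N + q).factorial / N.factorial := by
  induction p generalizing q N with
  | zero =>
    have : (N.factorial : ℝ) ≠ 0 := by positivity
    simp; field_simp
  | succ p ih =>
    have h := sum_choose_succ_mul
      (fun i j => (-1 : ℝ) ^ i * q.descFactorial i * (N + q + j).factorial) p
    rw [h]
    have hN : (N.factorial : ℝ) ≠ 0 := by positivity
    have h1 := ih q (N + 1)
    have h2 : ∑ i ∈ range (p + 1), (p.choose i : ℝ) *
        ((-1) ^ i * q.descFactorial i * (N + q + (p + 1 - i)).factorial) =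
        (N + 1 + p).factorial * (N + 1 + q).factorial / (N + 1).factorial := by
      rw [← h1]
      refine sum_congr rfl fun i hi => ?_
      have : N + q + (p + 1 - i) = N + 1 + q + (p - i) := by grind
      rw [this]
    rw [h2]
    rcases q with _ | q
    · rw [show N + (p + 1) = N + 1 + p by ring]
      simp
      field_simp
    · have h3 : ∑ i ∈ range (p + 1), (p.choose i : ℝ) *
          ((-1) ^ (i + 1) * (q + 1).descFactorial (i + 1) * (N + (q + 1) + (p - i)).factorial) =
          -(q + 1) * ((N + 1 + p).factorial * (N + 1 + q).factorial / (N + 1).factorial) := by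
        rw [← ih q (N + 1), mul_sum]
        refine sum_congr rfl fun i hi => ?_
        rw [Nat.succ_descFactorial_succ, add_right_comm N 1, ← add_assoc N q 1]
        push_cast
        ring
      rw [h3, show N + (p + 1) = N + 1 + p by ring, show N + (q + 1) = N + 1 + q by ring,
        show N + 1 + (q + 1) = (N + 1 + q) + 1 by ring, Nat.factorial_succ N,
        Nat.factorial_succ (N + 1 + q)]
      push_cast
      field_simp
      ring

/-- The boundary term of the telescoping for Gauss' theorem is `O(1/k)`: `(p+k)! (q+k)! ≤ k!
(p+q+k)!`, and the denominator has at least one further factor `p+q+k+1`. -/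
theorem poch_mul_poch_div_le (p q N k : ℕ) :
    poch (p + 1) k * poch q (k + 1) / (poch (p + q + N + 2) k * k.factorial) ≤
      q * ((p + q + N + 1).factorial / (p.factorial * q.factorial)) / (k + 1) := by
  have h1 := factorial_mul_poch p k
  have h2 := factorial_mul_poch q k
  have h3 := factorial_mul_poch (p + q + N + 1) k
  have h4 : (p + k).factorial * (q + k).factorial ≤ k.factorial * (p + q + k).factorial := by
    have := Nat.factorial_mul_ascFactorial k p
    have h6 := Nat.factorial_mul_ascFactorial (k + q) p
    have h5 : (k + 1).ascFactorial p ≤ (k + q + 1).ascFactorial p :=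
      Nat.ascFactorial_le p (by omega)
    rw [add_comm p k, ← this, add_comm q k, show p + q + k = k + q + p by ring, ← h6]
    calc _ = k.factorial * (k + q).factorial * (k + 1).ascFactorial p := by ring
      _ ≤ k.factorial * (k + q).factorial * (k + q + 1).ascFactorial p := by gcongr
      _ = _ := by ring
  have h5 : (k + 1) * (p + q + k).factorial ≤ (p + q + N + 1 + k).factorial := by
    calc _ ≤ (p + q + k + 1) * (p + q + k).factorial := by gcongr; omega
      _ = (p + q + k + 1).factorial := (Nat.factorial_succ _).symm
      _ ≤ _ := Nat.factorial_le (by omega)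
  have h6 : ((k : ℝ) + 1) * ((p + k).factorial * (q + k).factorial) ≤
      k.factorial * (p + q + N + 1 + k).factorial := by
    have : (k + 1) * ((p + k).factorial * (q + k).factorial) ≤
      k.factorial * (p + q + N + 1 + k).factorial := by
      calc _ ≤ (k + 1) * (k.factorial * (p + q + k).factorial) := by gcongr
        _ = k.factorial * ((k + 1) * (p + q + k).factorial) := by ring
        _ ≤ _ := by gcongr
    exact_mod_cast this
  rw [← h1, ← h2, ← h3] at h6
  have hp : (0 : ℝ) < p.factorial := by positivity
  have hq : (0 : ℝ) < q.factorial := by positivity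
  have hN : (0 : ℝ) < (p + q + N + 1).factorial := by positivity
  have e : ((p + q + N + 1 : ℕ) : ℝ) + 1 = p + q + N + 2 := by push_cast; ring
  rw [e] at h6
  have hD : 0 < poch ((p : ℝ) + q + N + 2) k := poch_pos (by positivity) k
  rw [poch_succ_left, div_le_div_iff₀ (by positivity) (by positivity), mul_div_assoc',
    div_mul_eq_mul_div, le_div_iff₀ (by positivity)]
  nlinarith [mul_le_mul_of_nonneg_left h6 (Nat.cast_nonneg q : (0 : ℝ) ≤ q)]

theorem tendsto_poch_mul_poch_div (p q N : ℕ) :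
    Tendsto (fun k : ℕ => poch (p + 1) k * poch q (k + 1) /
      (poch (p + q + N + 2) k * k.factorial)) atTop (𝓝 0) := by
  refine squeeze_zero (fun k => ?_) (poch_mul_poch_div_le p q N) ?_
  · have h1 : 0 ≤ poch ((p : ℝ) + 1) k := poch_nonneg (by positivity) k
    have h2 : 0 ≤ poch (q : ℝ) (k + 1) := poch_nonneg (by positivity) _
    have h3 : 0 ≤ poch ((p : ℝ) + q + N + 2) k := poch_nonneg (by positivity) k
    positivity
  · exact (tendsto_const_nhds.div_atTop
      (tendsto_atTop_add_const_right _ _ tendsto_natCast_atTop_atTop))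

/-- The contiguous relation between the Gauss series with parameters `p` and `p + 1`, at the level
of partial sums. -/
theorem sum_range_gauss_telescope (p q N K : ℕ) :
    ∑ k ∈ range (K + 1), ((p + N + 1 : ℝ) * (poch ((p : ℝ) + 1) k * poch q k /
        (poch (p + 1 + q + N + 1) k * k.factorial)) -
      (p + q + N + 1) * (poch p k * poch q k / (poch (p + q + N + 1) k * k.factorial))) =
    -(poch (p + 1) K * poch q (K + 1) / (poch (p + q + N + 2) K * K.factorial)) := by
  induction K with
  | zero => simp [poch_zero, poch_succ]
  | succ K ih =>
    rw [sum_range_succ, ih]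
    have e1 : (p : ℝ) + 1 + q + N + 1 = p + q + N + 2 := by ring
    have e2 : poch ((p : ℝ) + q + N + 1) (K + 1) =
        (p + q + N + 1) * poch ((p : ℝ) + q + N + 2) K := by
      rw [poch_succ_left]; ring_nf
    have hD : 0 < poch ((p : ℝ) + q + N + 2) K := poch_pos (by positivity) K
    rw [e1, e2, poch_succ_left (p : ℝ), poch_succ (q : ℝ) (K + 1), poch_succ ((p : ℝ) + 1),
      poch_succ ((p : ℝ) + q + N + 2), Nat.factorial_succ]
    generalize poch ((p : ℝ) + q + N + 2) K = D at *
    generalize poch ((p : ℝ) + 1) K = P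
    generalize poch (q : ℝ) (K + 1) = Q
    push_cast
    field_simp
    ring

/-- Gauss' summation theorem for `₂F₁(p, q; p + q + N + 1; 1)` with natural parameters. -/
theorem hasSum_gauss (p q N : ℕ) :
    HasSum (fun k : ℕ => poch p k * poch q k / (poch (p + q + N + 1) k * k.factorial))
      (N.factorial * (p + q + N).factorial / ((p + N).factorial * (q + N).factorial)) := by
  have hnn : ∀ p : ℕ, ∀ k : ℕ,
      0 ≤ poch (p : ℝ) k * poch q k / (poch ((p : ℝ) + q + N + 1) k * k.factorial) := by
    intro p k
    have h1 : 0 ≤ poch (p : ℝ) k := poch_nonneg (by positivity) k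
    have h2 : 0 ≤ poch (q : ℝ) k := poch_nonneg (by positivity) _
    have h3 : 0 ≤ poch ((p : ℝ) + q + N + 1) k := poch_nonneg (by positivity) k
    positivity
  -- At `p = 0` only the constant term survives; the contiguous relation, whose boundary term tends
  -- to `0`, raises `p`.
  induction p with
  | zero =>
    have h : ∀ k ≠ 0, poch ((0 : ℕ) : ℝ) k * poch q k /
        (poch (((0 : ℕ) : ℝ) + q + N + 1) k * k.factorial) = 0 := by
      intro k hk
      obtain ⟨k, rfl⟩ := Nat.exists_eq_succ_of_ne_zero hk
      simp [poch_succ_left]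
    have := hasSum_single 0 h
    convert! this using 1
    simp only [poch_zero]
    simp [Nat.factorial_ne_zero, add_comm q N]
  | succ p ih =>
    rw [hasSum_iff_tendsto_nat_of_nonneg (hnn _)]
    have h1 := (tendsto_add_atTop_iff_nat 1).2 ((hasSum_iff_tendsto_nat_of_nonneg (hnn p) _).1 ih)
    rw [← tendsto_add_atTop_iff_nat 1]
    have h2 := ((h1.const_mul ((p : ℝ) + q + N + 1)).add
      (tendsto_poch_mul_poch_div p q N).neg).div_const ((p : ℝ) + N + 1)
    have hpN : (p : ℝ) + N + 1 ≠ 0 := by positivity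
    refine (h2.congr fun K => ?_).trans_eq ?_
    · rw [← sum_range_gauss_telescope, sum_sub_distrib, ← mul_sum, ← mul_sum]
      push_cast
      field_simp
      ring
    · congr 1
      rw [show p + 1 + q + N = p + q + N + 1 by ring, show p + 1 + N = p + N + 1 by ring,
        Nat.factorial_succ, Nat.factorial_succ]
      push_cast
      field_simp
      ring

end ComplexSphere

/-! ### The coefficients `S_n^{p,q}(r)` -/

namespace ComplexSphere

open Finset Filter Topology

/-- The `k`-th term of the series `₂F₁(p, q; p + q + N + 1; 1)`. -/
noncomputable def gaussTerm (N p q k : ℕ) : ℝ :=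
  poch p k * poch q k / (poch (p + q + N + 1) k * k.factorial)

/-- The value `₂F₁(p, q; p + q + N + 1; 1)`. -/
noncomputable def gaussSum (N p q : ℕ) : ℝ :=
  N.factorial * (p + q + N).factorial / ((p + N).factorial * (q + N).factorial)

theorem gaussSum_pos (N p q : ℕ) : 0 < gaussSum N p q := by
  unfold gaussSum; positivity

theorem hasSum_gaussTerm (N p q : ℕ) : HasSum (gaussTerm N p q) (gaussSum N p q) :=
  hasSum_gauss p q N

theorem gaussTerm_nonneg (N p q k : ℕ) : 0 ≤ gaussTerm N p q k := by
  have h1 : 0 ≤ poch (p : ℝ) k := poch_nonneg (by positivity) k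
  have h2 : 0 ≤ poch (q : ℝ) k := poch_nonneg (by positivity) _
  have h3 : 0 ≤ poch ((p : ℝ) + q + N + 1) k := poch_nonneg (by positivity) k
  unfold gaussTerm
  positivity

theorem gaussTerm_mul_pow_le (N p q k : ℕ) {x : ℝ} (hx0 : 0 ≤ x) (hx1 : x ≤ 1) :
    gaussTerm N p q k * x ^ k ≤ gaussTerm N p q k :=
  mul_le_of_le_one_right (gaussTerm_nonneg N p q k) (pow_le_one₀ hx0 hx1)

theorem summable_gaussTerm_mul_pow (N p q : ℕ) {x : ℝ} (hx0 : 0 ≤ x) (hx1 : x ≤ 1) :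
    Summable fun k => gaussTerm N p q k * x ^ k :=
  (hasSum_gaussTerm N p q).summable.of_nonneg_of_le
    (fun k => mul_nonneg (gaussTerm_nonneg N p q k) (pow_nonneg hx0 k))
    fun k => gaussTerm_mul_pow_le N p q k hx0 hx1

/-- Pulling `(p+q+N)!` out of `(p+q+N+k)!` turns the factorial prefactor into the reciprocal of
Gauss' value. -/
theorem szegoTerm_eq (N p q : ℕ) (r : ℝ) (k : ℕ) :
    szegoTerm (N + 1) p q r k =
      r ^ (p + q) / gaussSum N p q * (gaussTerm N p q k * (r ^ 2) ^ k) := by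
  have h := factorial_mul_poch (p + q + N) k
  push_cast at h
  have hD : 0 < poch ((p : ℝ) + q + N + 1) k := poch_pos (by positivity) k
  unfold szegoTerm gaussSum gaussTerm
  rw [show N + 1 - 1 + p + q + k = p + q + N + k by omega, ← h, Nat.add_sub_cancel,
    ← add_assoc p N 1, ← add_assoc q N 1, Nat.add_sub_cancel, Nat.add_sub_cancel, pow_mul]
  field_simp

theorem summable_szegoTerm (N p q : ℕ) {r : ℝ} (hr0 : 0 ≤ r) (hr1 : r ≤ 1) :
    Summable (szegoTerm (N + 1) p q r) := by
  have : szegoTerm (N + 1) p q r = _ := funext (szegoTerm_eq N p q r)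
  rw [this]
  exact (summable_gaussTerm_mul_pow N p q (by positivity) (by nlinarith)).mul_left _

theorem szegoTerm_nonneg (n p q : ℕ) {r : ℝ} (hr0 : 0 ≤ r) (k : ℕ) : 0 ≤ szegoTerm n p q r k := by
  have h1 : 0 ≤ poch (p : ℝ) k := poch_nonneg (by positivity) k
  have h2 : 0 ≤ poch (q : ℝ) k := poch_nonneg (by positivity) _
  unfold szegoTerm
  positivity

theorem szegoCoeff_nonneg (n p q : ℕ) {r : ℝ} (hr0 : 0 ≤ r) : 0 ≤ szegoCoeff n p q r :=
  tsum_nonneg (szegoTerm_nonneg n p q hr0)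

theorem szegoCoeff_eq (N p q : ℕ) (r : ℝ) :
    szegoCoeff (N + 1) p q r =
      r ^ (p + q) / gaussSum N p q * ∑' k, gaussTerm N p q k * (r ^ 2) ^ k := by
  unfold szegoCoeff
  simp_rw [szegoTerm_eq]
  exact tsum_mul_left

/-- The hypergeometric series has nonnegative coefficients, so its value at `r²` is at most its
value at `1`. -/
theorem szegoCoeff_le (N p q : ℕ) {r : ℝ} (hr0 : 0 ≤ r) (hr1 : r ≤ 1) :
    szegoCoeff (N + 1) p q r ≤ r ^ (p + q) := by
  have hr : r ^ 2 ≤ 1 := by nlinarith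
  have h : ∑' k, gaussTerm N p q k * (r ^ 2) ^ k ≤ gaussSum N p q := by
    rw [← (hasSum_gaussTerm N p q).tsum_eq]
    exact (summable_gaussTerm_mul_pow N p q (by positivity) hr).tsum_le_tsum
      (fun k => gaussTerm_mul_pow_le N p q k (by positivity) hr) (hasSum_gaussTerm N p q).summable
  have hG := gaussSum_pos N p q
  rw [szegoCoeff_eq, div_mul_eq_mul_div, div_le_iff₀ hG]
  gcongr

theorem hypergeometricCoefficient_eq_gaussTerm (N p q k : ℕ) :
    ordinaryHypergeometricCoefficient (p : ℝ) (q : ℝ) ((p : ℝ) + q + (N + 1 : ℕ)) k =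
      gaussTerm N p q k := by
  unfold gaussTerm poch
  push_cast
  rw [← add_assoc, div_eq_mul_inv, mul_inv]
  ring

theorem hypergeometric_eq_tsum_gaussTerm (N p q : ℕ) (x : ℝ) :
    ordinaryHypergeometric (p : ℝ) (q : ℝ) ((p : ℝ) + q + (N + 1 : ℕ)) x =
      ∑' k, gaussTerm N p q k * x ^ k := by
  rw [ordinaryHypergeometric_eq_tsum]
  exact tsum_congr fun k => by rw [← hypergeometricCoefficient_eq_gaussTerm, smul_eq_mul]

theorem hypergeometric_one_eq_gaussSum (N p q : ℕ) :
    ordinaryHypergeometric (p : ℝ) (q : ℝ) ((p : ℝ) + q + (N + 1 : ℕ)) (1 : ℝ) =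
      gaussSum N p q := by
  rw [hypergeometric_eq_tsum_gaussTerm, ← (hasSum_gaussTerm N p q).tsum_eq]
  simp

/-- The `HasSum` conjunct has content: `ordinaryHypergeometric` is a `tsum`, which would be `0` by
default if the series at `1` diverged. -/
theorem hypergeometric_form (N p q : ℕ) (r : ℝ) :
    HasSum (fun k : ℕ => ordinaryHypergeometricCoefficient (p : ℝ) (q : ℝ)
        ((p : ℝ) + q + (N + 1 : ℕ)) k)
      (ordinaryHypergeometric (p : ℝ) (q : ℝ) ((p : ℝ) + q + (N + 1 : ℕ)) (1 : ℝ)) ∧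
    0 < ordinaryHypergeometric (p : ℝ) (q : ℝ) ((p : ℝ) + q + (N + 1 : ℕ)) (1 : ℝ) ∧
    szegoCoeff (N + 1) p q r =
      r ^ (p + q) *
        ordinaryHypergeometric (p : ℝ) (q : ℝ) ((p : ℝ) + q + (N + 1 : ℕ)) (r ^ 2) /
        ordinaryHypergeometric (p : ℝ) (q : ℝ) ((p : ℝ) + q + (N + 1 : ℕ)) (1 : ℝ) := by
  rw [hypergeometric_one_eq_gaussSum, hypergeometric_eq_tsum_gaussTerm, szegoCoeff_eq]
  refine ⟨?_, gaussSum_pos N p q, by ring⟩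
  simp_rw [hypergeometricCoefficient_eq_gaussTerm]
  exact hasSum_gaussTerm N p q

theorem szegoTerm_eq_factorial (n p q : ℕ) (hp : 1 ≤ p) (hq : 1 ≤ q) (r : ℝ) (k : ℕ) :
    szegoTerm n p q r k =
      r ^ (p + q) *
        (((p + n - 1).factorial * (q + n - 1).factorial : ℝ) /
          ((n - 1).factorial * (p - 1).factorial * (q - 1).factorial)) *
        (((p + k - 1).factorial * (q + k - 1).factorial : ℝ) /
          (n - 1 + p + q + k).factorial * (r ^ (2 * k) / k.factorial)) := by
  obtain ⟨p, rfl⟩ := Nat.exists_eq_add_of_le' hp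
  obtain ⟨q, rfl⟩ := Nat.exists_eq_add_of_le' hq
  have h1 := factorial_mul_poch p k
  have h2 := factorial_mul_poch q k
  rw [show p + 1 + k - 1 = p + k by omega, show q + 1 + k - 1 = q + k by omega, ← h1, ← h2,
    szegoTerm, Nat.add_sub_cancel, Nat.add_sub_cancel]
  push_cast
  field_simp

end ComplexSphere

/-! ### Bihomogeneous polynomials as weighted homogeneous polynomials -/

namespace ComplexSphere

open Finset MvPolynomial

/-- The bidegree of the variables: `(1, 0)` for `z_j` and `(0, 1)` for its conjugate. -/
def bidegreeWeight (n : ℕ) : Fin n ⊕ Fin n → ℕ × ℕ :=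
  Sum.elim (fun _ => (1, 0)) (fun _ => (0, 1))

theorem weight_bidegreeWeight {n : ℕ} (d : Fin n ⊕ Fin n →₀ ℕ) :
    Finsupp.weight (bidegreeWeight n) d = (∑ j, d (Sum.inl j), ∑ j, d (Sum.inr j)) := by
  rw [Finsupp.weight_apply, Finsupp.sum_fintype _ _ (by simp)]
  ext <;> simp [bidegreeWeight, Prod.fst_sum, Prod.snd_sum]

/-- The substitution `z = x + iy`, `z̄ = x - iy` (`f`, with inverse `g`) is an invertible change of
variables. It turns values at points of `ℂⁿ` into values at real points, and these determine a
polynomial. -/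
theorem ConjPolynomial.value_injective {n : ℕ} {P Q : ConjPolynomial n}
    (h : ∀ z, P.value z = Q.value z) : P = Q := by
  let f : Fin n ⊕ Fin n → ConjPolynomial n :=
    Sum.elim (fun j => X (Sum.inl j) + C Complex.I * X (Sum.inr j))
      (fun j => X (Sum.inl j) - C Complex.I * X (Sum.inr j))
  let g : Fin n ⊕ Fin n → ConjPolynomial n :=
    Sum.elim (fun j => C (1 / 2) * (X (Sum.inl j) + X (Sum.inr j)))
      (fun j => C (1 / (2 * Complex.I)) * (X (Sum.inl j) - X (Sum.inr j)))
  have hfg : ∀ P : ConjPolynomial n, bind₁ g (bind₁ f P) = P := by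
    intro P
    have hI : (C Complex.I : ConjPolynomial n) * C (1 / (2 * Complex.I)) = C (1 / 2) := by
      rw [← C_mul]; congr 1; field_simp [Complex.I_ne_zero]
    have h2 : (C (1 / 2) : ConjPolynomial n) + C (1 / 2) = 1 := by
      rw [← C_add]; norm_num
    rw [bind₁_bind₁]
    have : (fun i => bind₁ g (f i)) = X := by
      funext i
      rcases i with j | j
      · simp only [f, g, Sum.elim_inl, map_add, bind₁_X_right, map_mul, bind₁_C_right,
          Sum.elim_inr]
        linear_combination (X (Sum.inl j) - X (Sum.inr j)) * hI + X (Sum.inl j) * h2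
      · simp only [f, g, Sum.elim_inl, map_sub, bind₁_X_right, map_mul, bind₁_C_right,
          Sum.elim_inr]
        linear_combination -(X (Sum.inl j) - X (Sum.inr j)) * hI + X (Sum.inr j) * h2
    rw [this]
    exact aeval_X_left_apply P
  rw [← hfg P, ← hfg Q]
  congr 1
  refine funext_set (fun _ => Set.range ((↑) : ℝ → ℂ))
    (fun _ => Set.infinite_range_of_injective Complex.ofReal_injective) fun x hx => ?_
  have hx' : ∀ i, starRingEnd ℂ (x i) = x i := by
    intro i
    obtain ⟨y, hy⟩ := hx i (Set.mem_univ i)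
    rw [← hy, Complex.conj_ofReal]
  have key : ∀ P : ConjPolynomial n, eval x (bind₁ f P) =
      P.value (WithLp.toLp 2 fun j => x (Sum.inl j) + Complex.I * x (Sum.inr j)) := by
    intro P
    refine (eval₂Hom_bind₁ (RingHom.id ℂ) x f P).trans ?_
    unfold ConjPolynomial.value
    congr 2
    funext i
    rcases i with j | j
    · simp [f]
    · simp [f, hx']
      ring
  rw [key, key, h]

/-- The substitution `z ↦ l z`, `z̄ ↦ m z̄`. -/
noncomputable def rescale (n : ℕ) (l m : ℂ) : ConjPolynomial n →ₐ[ℂ] ConjPolynomial n :=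
  bind₁ fun i => C (Sum.elim (fun _ => l) (fun _ => m) i) * X i

theorem coeff_rescale {n : ℕ} (l m : ℂ) (P : ConjPolynomial n) (d : Fin n ⊕ Fin n →₀ ℕ) :
    coeff d (rescale n l m P) =
      l ^ (∑ j, d (Sum.inl j)) * m ^ (∑ j, d (Sum.inr j)) * coeff d P := by
  induction P using MvPolynomial.induction_on' with
  | monomial e c =>
    have : rescale n l m (monomial e c) =
        monomial e (l ^ (∑ j, e (Sum.inl j)) * m ^ (∑ j, e (Sum.inr j)) * c) := by
      rw [rescale, bind₁_monomial, monomial_eq (s := e)]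
      have h1 : (e.prod fun i k =>
          (C (Sum.elim (fun _ => l) (fun _ => m) i) * X i : ConjPolynomial n) ^ k) =
          ∏ i, (C (Sum.elim (fun _ => l) (fun _ => m) i) * X i : ConjPolynomial n) ^ e i :=
        Finsupp.prod_fintype _ _ (by simp)
      have h2 : (∏ i, (C (Sum.elim (fun _ => l) (fun _ => m) i) : ConjPolynomial n) ^ e i) =
          C (l ^ (∑ j, e (Sum.inl j)) * m ^ (∑ j, e (Sum.inr j))) := by
        simp [Fintype.prod_sum_type, Finset.prod_pow_eq_pow_sum]
      have h3 : (e.prod fun i k => (X i : ConjPolynomial n) ^ k) = ∏ i, X i ^ e i :=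
        Finsupp.prod_fintype _ _ (by simp)
      change C c * (e.prod fun i k => (C (Sum.elim (fun _ => l) (fun _ => m) i) * X i) ^ k) = _
      rw [h1, h3]
      simp only [mul_pow, Finset.prod_mul_distrib]
      rw [h2, C_mul, C_mul, C_mul]
      ring
    rw [this, coeff_monomial, coeff_monomial]
    split_ifs with h
    · rw [h]
    · simp
  | add P Q hP hQ => rw [map_add, coeff_add, hP, hQ, coeff_add, mul_add]

theorem ConjPolynomial.value_smul {n : ℕ} (P : ConjPolynomial n) (l : ℂ)
    (z : EuclideanSpace ℂ (Fin n)) :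
    P.value (l • z) = ConjPolynomial.value (rescale n l (starRingEnd ℂ l) P) z := by
  refine Eq.trans ?_ (eval₂Hom_bind₁ (RingHom.id ℂ) _ _ P).symm
  unfold ConjPolynomial.value
  change eval _ P = eval _ P
  congr 2
  funext i
  rcases i with j | j <;> simp

theorem bihomogeneous_eq (n p q : ℕ) :
    bihomogeneous n p q = weightedHomogeneousSubmodule ℂ (bidegreeWeight n) (p, q) := by
  ext P
  rw [mem_weightedHomogeneousSubmodule]
  have h1 : P ∈ bihomogeneous n p q ↔
      ∀ l : ℂ, rescale n l (starRingEnd ℂ l) P = (l ^ p * (starRingEnd ℂ l) ^ q) • P := by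
    refine ⟨fun h l => ConjPolynomial.value_injective fun z => ?_, fun h l z => ?_⟩
    · rw [← ConjPolynomial.value_smul, h l z]
      simp [ConjPolynomial.value, smul_eval]
    · rw [ConjPolynomial.value_smul, h l]
      simp [ConjPolynomial.value, smul_eval]
  rw [h1]
  simp only [MvPolynomial.ext_iff, coeff_rescale, coeff_smul, smul_eq_mul]
  constructor
  · intro h d hd
    rw [weight_bidegreeWeight]
    have h2 : ∀ l : ℂ, l ^ (∑ j, d (Sum.inl j)) * (starRingEnd ℂ l) ^ (∑ j, d (Sum.inr j)) =
        l ^ p * (starRingEnd ℂ l) ^ q := fun l => mul_right_cancel₀ hd (h l d)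
    generalize (∑ j, d (Sum.inl j)) = a at *
    generalize (∑ j, d (Sum.inr j)) = b at *
    have h3 : a + b = p + q := by
      -- A real scalar sees only the total degree; the unimodular scalar below sees only the
      -- difference of the two degrees.
      have := h2 ((2 : ℕ) : ℂ)
      rw [map_natCast, ← pow_add, ← pow_add] at this
      exact Nat.pow_right_injective le_rfl (by exact_mod_cast this)
    have h4 : (a : ℤ) - b = p - q := by
      by_contra hne
      have hk : ((a : ℝ) - b - (p - q)) ≠ 0 := by
        intro h0
        apply hne
        have : (a : ℝ) - b = p - q := by linarith
        exact_mod_cast this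
      -- This angle makes the quotient of the two characters at `e^(it)` equal to `e^(iπ) = -1`,
      -- whereas `h2` makes it `1`.
      set t : ℝ := Real.pi / ((a : ℝ) - b - (p - q)) with ht
      have h5 := h2 (Complex.exp (t * Complex.I))
      rw [← Complex.exp_conj, map_mul, Complex.conj_ofReal, Complex.conj_I, ← Complex.exp_nat_mul,
        ← Complex.exp_nat_mul, ← Complex.exp_nat_mul, ← Complex.exp_nat_mul, ← Complex.exp_add,
        ← Complex.exp_add] at h5
      have h6 : Complex.exp (Real.pi * Complex.I) = 1 := by
        rw [← div_eq_one_iff_eq (Complex.exp_ne_zero _), ← Complex.exp_sub] at h5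
        rw [← h5]
        congr 1
        have : (Real.pi : ℂ) = t * ((a : ℂ) - b - (p - q)) := by
          have : Real.pi = t * ((a : ℝ) - b - (p - q)) := by rw [ht]; field_simp
          exact_mod_cast this
        rw [this]
        ring
      rw [Complex.exp_pi_mul_I] at h6
      norm_num at h6
    ext <;> simp <;> omega
  · intro h l d
    by_cases hd : coeff d P = 0
    · simp [hd]
    · have := h hd
      rw [weight_bidegreeWeight, Prod.mk.injEq] at this
      rw [this.1, this.2]

/-- An exponent of bidegree `(p, q)` is a pair of exponents of degrees `p` and `q`. -/
noncomputable def bidegreeEquiv (n p q : ℕ) :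
    {d : Fin n ⊕ Fin n →₀ ℕ | Finsupp.weight (bidegreeWeight n) d = (p, q)} ≃
      (univ : Finset (Fin n)).finsuppAntidiag p × (univ : Finset (Fin n)).finsuppAntidiag q :=
  (Finsupp.sumFinsuppEquivProdFinsupp.subtypeEquiv (q := fun x =>
    x.1 ∈ (univ : Finset (Fin n)).finsuppAntidiag p ∧
    x.2 ∈ (univ : Finset (Fin n)).finsuppAntidiag q) (by
    intro d
    simp [weight_bidegreeWeight, mem_finsuppAntidiag]
    rfl)).trans
    (Equiv.subtypeProdEquivProd)

theorem finrank_bihomogeneous (n p q : ℕ) :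
    Module.finrank ℂ (bihomogeneous n p q) = n.multichoose p * n.multichoose q := by
  rw [bihomogeneous_eq, weightedHomogeneousSubmodule_eq_finsupp_supported]
  have := Module.finrank_eq_nat_card_basis
    (basisRestrictSupport ℂ {d | Finsupp.weight (bidegreeWeight n) d = (p, q)})
  refine this.trans ?_
  rw [Nat.card_congr (bidegreeEquiv n p q), Nat.card_prod,
    Nat.card_eq_fintype_card, Nat.card_eq_fintype_card,
    Fintype.card_coe, Fintype.card_coe, card_finsuppAntidiag_nat_eq_multichoose,
    card_finsuppAntidiag_nat_eq_multichoose, card_univ, Fintype.card_fin]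

instance (n p q : ℕ) : Module.Finite ℂ (bihomogeneous n p q) := by
  rw [bihomogeneous_eq, weightedHomogeneousSubmodule_eq_finsupp_supported]
  have := Finite.of_equiv _ (bidegreeEquiv n p q).symm
  exact Module.Finite.of_basis
    (basisRestrictSupport ℂ {d | Finsupp.weight (bidegreeWeight n) d = (p, q)})

end ComplexSphere

/-! ### Surjectivity of the Laplacian and the dimension of the harmonic spaces -/

namespace ComplexSphere

open Finset MvPolynomial

theorem laplacian_apply {n : ℕ} (P : ConjPolynomial n) :
    laplacian n P = (4 : ℂ) • ∑ j, pderiv (Sum.inl j) (pderiv (Sum.inr j) P) := by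
  simp [laplacian]

theorem laplacian_mem_bihomogeneous {n p q : ℕ} {P : ConjPolynomial n}
    (hP : P ∈ bihomogeneous n (p + 1) (q + 1)) : laplacian n P ∈ bihomogeneous n p q := by
  rw [laplacian_apply]
  rw [bihomogeneous_eq] at hP ⊢
  refine Submodule.smul_mem _ _ (Submodule.sum_mem _ fun j _ => ?_)
  have h1 : (pderiv (Sum.inr j) P).IsWeightedHomogeneous (bidegreeWeight n) (p + 1, q) :=
    IsWeightedHomogeneous.pderiv hP (by simp [bidegreeWeight])
  exact IsWeightedHomogeneous.pderiv h1 (by simp [bidegreeWeight])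

theorem laplacian_monomial {n : ℕ} (d : Fin n ⊕ Fin n →₀ ℕ) (c : ℂ) :
    laplacian n (monomial d c) = ∑ j, monomial
      (d - Finsupp.single (Sum.inr j) 1 - Finsupp.single (Sum.inl j) 1)
      (4 * c * d (Sum.inl j) * d (Sum.inr j)) := by
  rw [laplacian_apply, Finset.smul_sum]
  refine sum_congr rfl fun j _ => ?_
  rw [pderiv_monomial, pderiv_monomial, smul_monomial]
  simp
  ring_nf

theorem laplacian_eq_zero_of_bidegree {n p q : ℕ} (h : p = 0 ∨ q = 0) {P : ConjPolynomial n}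
    (hP : P ∈ bihomogeneous n p q) : laplacian n P = 0 := by
  rw [bihomogeneous_eq] at hP
  rw [P.as_sum, map_sum]
  refine Finset.sum_eq_zero fun d hd => ?_
  have hw := hP (mem_support_iff.1 hd)
  rw [weight_bidegreeWeight, Prod.mk.injEq] at hw
  rw [laplacian_monomial]
  refine Finset.sum_eq_zero fun j _ => ?_
  rcases h with rfl | rfl
  · have : d (Sum.inl j) = 0 := Finset.sum_eq_zero_iff.1 hw.1 j (mem_univ j)
    simp [this]
  · have : d (Sum.inr j) = 0 := Finset.sum_eq_zero_iff.1 hw.2 j (mem_univ j)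
    simp [this]

/-- The Laplacian of `z^d · z_{j₀} z̄_{j₀}` is a nonzero multiple of `z^d` plus terms for `j ≠ j₀`
in which `z_j z̄_j` has been replaced by `z_{j₀} z̄_{j₀}`. Those have a larger exponent at `z_{j₀}`,
so `h` covers them. -/
theorem monomial_mem_map_laplacian_step {n p q : ℕ} (j₀ : Fin n) (d : Fin n ⊕ Fin n →₀ ℕ)
    (hd : Finsupp.weight (bidegreeWeight n) d = (p, q)) (c : ℂ)
    (h : ∀ j ≠ j₀, d (Sum.inl j) ≠ 0 → ∀ e : Fin n ⊕ Fin n →₀ ℕ,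
      e (Sum.inl j₀) = d (Sum.inl j₀) + 1 → Finsupp.weight (bidegreeWeight n) e = (p, q) →
      ∀ c, monomial e c ∈ (bihomogeneous n (p + 1) (q + 1)).map (laplacian n)) :
    monomial d c ∈ (bihomogeneous n (p + 1) (q + 1)).map (laplacian n) := by
  set e : Fin n ⊕ Fin n →₀ ℕ :=
    d + Finsupp.single (Sum.inl j₀) 1 + Finsupp.single (Sum.inr j₀) 1 with he
  have hwe : Finsupp.weight (bidegreeWeight n) e = (p + 1, q + 1) := by
    rw [he, map_add, map_add, hd, Finsupp.weight_single, Finsupp.weight_single]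
    simp [bidegreeWeight]
  have hk : (4 * ((d (Sum.inl j₀) : ℂ) + 1) * (d (Sum.inr j₀) + 1)) ≠ 0 := by
    have h1 : (d (Sum.inl j₀) : ℂ) + 1 ≠ 0 := Nat.cast_add_one_ne_zero _
    have h2 : (d (Sum.inr j₀) : ℂ) + 1 ≠ 0 := Nat.cast_add_one_ne_zero _
    simp [h1, h2]
  set b : ℂ := c / (4 * ((d (Sum.inl j₀) : ℂ) + 1) * (d (Sum.inr j₀) + 1)) with hb
  have hmem : laplacian n (monomial e b) ∈
      (bihomogeneous n (p + 1) (q + 1)).map (laplacian n) := by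
    refine Submodule.mem_map_of_mem ?_
    rw [bihomogeneous_eq]
    exact isWeightedHomogeneous_monomial _ _ _ hwe
  rw [laplacian_monomial, ← Finset.add_sum_erase _ _ (mem_univ j₀)] at hmem
  have h0 : e - Finsupp.single (Sum.inr j₀) 1 - Finsupp.single (Sum.inl j₀) 1 = d := by
    ext i
    simp [he]
  have hc : 4 * b * e (Sum.inl j₀) * e (Sum.inr j₀) = c := by
    have : 4 * b * e (Sum.inl j₀) * e (Sum.inr j₀) =
        b * (4 * ((d (Sum.inl j₀) : ℂ) + 1) * (d (Sum.inr j₀) + 1)) := by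
      simp [he]
      ring
    rw [this, hb, div_mul_cancel₀ _ hk]
  rw [h0, hc] at hmem
  refine (Submodule.add_mem_iff_left _ (Submodule.sum_mem _ fun j hj => ?_)).1 hmem
  have hj' := ne_of_mem_erase hj
  by_cases hl : d (Sum.inl j) = 0
  · have : e (Sum.inl j) = 0 := by simp [he, hl, hj'.symm]
    simp [this]
  by_cases hr : d (Sum.inr j) = 0
  · have : e (Sum.inr j) = 0 := by simp [he, hr, hj'.symm]
    simp [this]
  refine h j hj' hl _ (by simp [he, hj']) ?_ _
  have hsum : e - Finsupp.single (Sum.inr j) 1 - Finsupp.single (Sum.inl j) 1 +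
      Finsupp.single (Sum.inl j) 1 + Finsupp.single (Sum.inr j) 1 = e := by
    ext i
    have h1 : 1 ≤ e (Sum.inl j) := by simp [he]; omega
    have h2 : 1 ≤ e (Sum.inr j) := by simp [he]; omega
    rcases i with i | i
    · by_cases hi : j = i
      · subst hi; simp; omega
      · simp [hi]
    · by_cases hi : j = i
      · subst hi; simp; omega
      · simp [hi]
  have hw := congrArg (Finsupp.weight (bidegreeWeight n)) hsum
  rw [hwe, map_add, map_add, Finsupp.weight_single, Finsupp.weight_single] at hw
  ext
  · simpa [bidegreeWeight] using congrArg Prod.fst hw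
  · simpa [bidegreeWeight] using congrArg Prod.snd hw

/-- Downward induction on the exponent of `z_{j₀}`, which is at most `p`; `N` bounds its distance
from `p`. -/
theorem monomial_mem_map_laplacian {n p q : ℕ} (j₀ : Fin n) (N : ℕ) (d : Fin n ⊕ Fin n →₀ ℕ)
    (hN : p ≤ d (Sum.inl j₀) + N) (hd : Finsupp.weight (bidegreeWeight n) d = (p, q)) (c : ℂ) :
    monomial d c ∈ (bihomogeneous n (p + 1) (q + 1)).map (laplacian n) := by
  induction N generalizing d c with
  | zero =>
    refine monomial_mem_map_laplacian_step j₀ d hd c fun j hj hl => absurd ?_ hl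
    rw [weight_bidegreeWeight, Prod.mk.injEq, ← Finset.add_sum_erase _ _ (mem_univ j₀)] at hd
    have : ∑ j ∈ univ.erase j₀, d (Sum.inl j) = 0 := by omega
    exact Finset.sum_eq_zero_iff.1 this j (mem_erase.2 ⟨hj, mem_univ j⟩)
  | succ N ih =>
    exact monomial_mem_map_laplacian_step j₀ d hd c fun j hj hl e he hwe c =>
      ih e (by omega) hwe c

theorem map_laplacian_bihomogeneous {n : ℕ} (hn : 0 < n) (p q : ℕ) :
    (bihomogeneous n (p + 1) (q + 1)).map (laplacian n) = bihomogeneous n p q := by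
  apply le_antisymm
  · rintro _ ⟨P, hP, rfl⟩
    exact laplacian_mem_bihomogeneous hP
  · intro P hP
    rw [bihomogeneous_eq] at hP
    rw [P.as_sum]
    exact Submodule.sum_mem _ fun d hd =>
      monomial_mem_map_laplacian ⟨0, hn⟩ p d (by omega) (hP (mem_support_iff.1 hd)) _

/-- Rank–nullity for the Laplacian restricted to bidegree `(p + 1, q + 1)`, whose range is all of
bidegree `(p, q)`. -/
theorem finrank_solidHarmonics_succ {n : ℕ} (hn : 0 < n) (p q : ℕ) :
    Module.finrank ℂ (solidHarmonics n (p + 1) (q + 1)) + n.multichoose p * n.multichoose q =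
      n.multichoose (p + 1) * n.multichoose (q + 1) := by
  have h := LinearMap.finrank_range_add_finrank_ker
    ((laplacian n).domRestrict (bihomogeneous n (p + 1) (q + 1)))
  rw [LinearMap.range_domRestrict, map_laplacian_bihomogeneous hn, finrank_bihomogeneous,
    finrank_bihomogeneous, LinearMap.ker_domRestrict] at h
  rw [← h, add_comm]
  congr 1
  have e : Submodule.comap (bihomogeneous n (p + 1) (q + 1)).subtype (laplacian n).ker =
      Submodule.comap (bihomogeneous n (p + 1) (q + 1)).subtype
        (solidHarmonics n (p + 1) (q + 1)) := by
    ext P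
    simp [solidHarmonics]
  rw [e]
  exact (Submodule.comapSubtypeEquivOfLe inf_le_right).finrank_eq.symm

theorem finrank_solidHarmonics_of_eq_zero (n : ℕ) {p q : ℕ} (h : p = 0 ∨ q = 0) :
    Module.finrank ℂ (solidHarmonics n p q) = n.multichoose p * n.multichoose q := by
  have : solidHarmonics n p q = bihomogeneous n p q :=
    inf_eq_right.2 fun P hP => laplacian_eq_zero_of_bidegree h hP
  rw [this, finrank_bihomogeneous]

theorem finrank_solidHarmonics_le (n p q : ℕ) :
    Module.finrank ℂ (solidHarmonics n p q) ≤ n.multichoose p * n.multichoose q := by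
  rw [← finrank_bihomogeneous]
  exact Submodule.finrank_mono inf_le_right

theorem multichoose_mul_factorial (M p : ℕ) :
    ((M + 2).multichoose p : ℝ) = (M + 1 + p).factorial / (p.factorial * (M + 1).factorial) := by
  rw [Nat.multichoose_eq, show M + 2 + p - 1 = p + (M + 1) by omega, Nat.cast_add_choose,
    add_comm p (M + 1)]

theorem finrank_solidHarmonics (M p q : ℕ) :
    (Module.finrank ℂ (solidHarmonics (M + 2) p q) : ℝ) =
      (p + q + M + 1) * ((p + M).factorial * (q + M).factorial) /
        (p.factorial * q.factorial * (M + 1).factorial * M.factorial) := by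
  by_cases h : p = 0 ∨ q = 0
  · rw [finrank_solidHarmonics_of_eq_zero _ h]
    push_cast
    rw [multichoose_mul_factorial, multichoose_mul_factorial]
    rcases h with rfl | rfl
    · rw [show M + 1 + q = q + M + 1 by ring, Nat.factorial_succ (q + M)]
      simp
      field_simp
    · rw [show M + 1 + p = p + M + 1 by ring, Nat.factorial_succ (p + M)]
      simp
      field_simp
  · push Not at h
    obtain ⟨p, rfl⟩ := Nat.exists_eq_succ_of_ne_zero h.1
    obtain ⟨q, rfl⟩ := Nat.exists_eq_succ_of_ne_zero h.2
    have h2 := finrank_solidHarmonics_succ (Nat.succ_pos (M + 1)) p q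
    have h3 := congrArg (Nat.cast : ℕ → ℝ) h2
    push_cast at h3
    simp only [Nat.succ_eq_add_one] at h3 ⊢
    rw [← eq_sub_iff_add_eq] at h3
    rw [show M + 2 = M + 1 + 1 by rfl, h3]
    simp only [show M + 1 + 1 = M + 2 by rfl, multichoose_mul_factorial]
    rw [show M + 1 + (p + 1) = p + M + 1 + 1 by ring, show M + 1 + p = p + M + 1 by ring,
      show M + 1 + (q + 1) = q + M + 1 + 1 by ring, show M + 1 + q = q + M + 1 by ring,
      show p + 1 + M = p + M + 1 by ring, show q + 1 + M = q + M + 1 by ring]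
    simp only [Nat.factorial_succ]
    push_cast
    field_simp
    ring

end ComplexSphere

/-! ### Disc polynomials and the Laplacian of products of invariants -/

namespace ComplexSphere

open Finset MvPolynomial

/-- The coefficient of `w ^ (p - i) * conj w ^ (q - i)` in the disc polynomial with `α = M`. -/
noncomputable def discCoeff (M p q i : ℕ) : ℝ :=
  poch (M + 1) (p + q) / (poch (M + 1) p * poch (M + 1) q) *
    (poch (-p) i * poch (-q) i / (poch (-M - p - q) i * (i.factorial : ℝ)))

theorem discPolynomial_eq_sum (M p q : ℕ) (w : ℂ) :
    discPolynomial M p q w = ∑ i ∈ range (min p q + 1),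
      (discCoeff M p q i : ℂ) * w ^ (p - i) * (starRingEnd ℂ w) ^ (q - i) := by
  unfold discPolynomial discCoeff
  rw [mul_sum]
  refine sum_congr rfl fun i _ => ?_
  push_cast
  ring

theorem discCoeff_zero_pos (M p q : ℕ) : 0 < discCoeff M p q 0 := by
  have h := fun k => poch_pos (by positivity : (0 : ℝ) < (M : ℝ) + 1) k
  have h1 := h p
  have h2 := h q
  have h3 := h (p + q)
  unfold discCoeff
  simp only [poch_zero]
  simp
  positivity

theorem poch_succ_div_poch (M p q : ℕ) :
    poch ((M : ℝ) + 1) (p + q) / (poch (M + 1) p * poch (M + 1) q) =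
      (M + p + q).factorial * M.factorial / ((M + p).factorial * (M + q).factorial) := by
  have h := fun k => poch_pos (by positivity : (0 : ℝ) < (M : ℝ) + 1) k
  have h1 := h p
  have h2 := h q
  rw [← factorial_mul_poch M p, ← factorial_mul_poch M q, add_assoc,
    ← factorial_mul_poch M (p + q)]
  field_simp

theorem poch_neg_add_natCast (M p q i : ℕ) :
    poch (-(M : ℝ) - p - q) i = (-1) ^ i * (M + p + q).descFactorial i := by
  rw [← poch_neg_natCast]
  push_cast
  ring_nf

theorem discCoeff_eq (M a b i : ℕ) :
    discCoeff M (a + i) (b + i) i =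
      (-1) ^ i * (a + i).factorial * (b + i).factorial * (M + a + b + i).factorial * M.factorial /
        ((M + a + i).factorial * (M + b + i).factorial * a.factorial * b.factorial *
          i.factorial) := by
  have hd : ∀ a : ℕ, (a.factorial : ℝ) * (a + i).descFactorial i = (a + i).factorial := by
    intro a
    have := Nat.factorial_mul_descFactorial (Nat.le_add_left i a)
    rw [Nat.add_sub_cancel] at this
    exact_mod_cast this
  have h1 := hd a
  have h2 := hd b
  have h3 := hd (M + a + b + i)
  have hpos : ((M + a + b + i + i).descFactorial i : ℝ) ≠ 0 := by
    intro h0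
    rw [h0, mul_zero] at h3
    exact (Nat.cast_ne_zero.2 (Nat.factorial_ne_zero _)) h3.symm
  unfold discCoeff
  rw [poch_succ_div_poch, poch_neg_natCast, poch_neg_natCast, poch_neg_add_natCast, ← add_assoc,
    ← add_assoc, show M + a + i + b + i = M + a + b + i + i by ring, ← h3, ← h1, ← h2,
    ← add_assoc M b i]
  have hs : ((-1 : ℝ) ^ i) ^ 2 = 1 := by rw [← pow_mul, mul_comm, pow_mul]; simp
  have hs0 : (-1 : ℝ) ^ i ≠ 0 := pow_ne_zero i (by norm_num)
  field_simp

theorem discPolynomial_one (M p q : ℕ) : discPolynomial M p q 1 = 1 := by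
  rw [discPolynomial_eq_sum]
  simp only [one_pow, map_one, mul_one]
  rw [← Complex.ofReal_sum]
  norm_cast
  -- The terms with `q < i ≤ p` vanish because `(-q)_i = 0`, so the sum has the range of
  -- Chu–Vandermonde.
  have hsub : range (min p q + 1) ⊆ range (p + 1) := by
    intro i; simp; omega
  rw [sum_subset hsub]
  · have h := sum_range_choose_mul_descFactorial_mul_factorial p q M
    have hK : ((M + p).factorial * (M + q).factorial / M.factorial : ℝ) ≠ 0 := by positivity
    apply mul_left_cancel₀ hK
    rw [mul_one]
    refine Eq.trans ?_ h
    rw [mul_sum]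
    refine sum_congr rfl fun i hi => ?_
    have hip : i ≤ p := by simpa [Nat.lt_succ_iff] using hi
    unfold discCoeff
    rw [poch_succ_div_poch, poch_neg_natCast, poch_neg_natCast, poch_neg_add_natCast,
      Nat.descFactorial_eq_factorial_mul_choose p i]
    have h3 := Nat.factorial_mul_descFactorial (show i ≤ M + p + q by omega)
    rw [← h3, show M + p + q - i = M + q + (p - i) by omega]
    have hpos : ((M + p + q).descFactorial i : ℝ) ≠ 0 := by
      intro h0
      rw [Nat.cast_eq_zero.1 h0, mul_zero] at h3
      exact (Nat.factorial_ne_zero _) h3.symm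
    have hs0 : (-1 : ℝ) ^ i ≠ 0 := pow_ne_zero i (by norm_num)
    push_cast
    field_simp
  · intro i hi hi'
    have : q < i := by simp at hi hi'; omega
    unfold discCoeff
    rw [poch_neg_natCast q, Nat.descFactorial_of_lt this]
    simp

/-- This two-term recurrence is exactly the condition for the homogenised disc polynomial to be
harmonic. -/
theorem discCoeff_succ (M p q i : ℕ) (hi : i < min p q) :
    discCoeff M p q (i + 1) * ((i + 1) * (M + p + q - i)) =
      -(discCoeff M p q i * ((p - i) * (q - i))) := by
  have h : (-(M : ℝ) - p - q + i) ≠ 0 := by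
    have h1 : (i : ℝ) < p := by exact_mod_cast (lt_min_iff.1 hi).1
    have h2 : (0 : ℝ) ≤ q := by positivity
    have h3 : (0 : ℝ) ≤ M := by positivity
    linarith [h1, h2, h3] |> ne_of_lt
  unfold discCoeff
  rw [poch_succ, poch_succ, poch_succ, Nat.factorial_succ]
  push_cast
  by_cases h0 : poch (-(M : ℝ) - p - q) i = 0
  · simp [h0]
  · field_simp
    ring

/-- The polynomial `(z|η)`. -/
noncomputable def hermPoly {n : ℕ} (η : EuclideanSpace ℂ (Fin n)) : ConjPolynomial n :=
  ∑ j, C (starRingEnd ℂ (η j)) * X (Sum.inl j)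

/-- The polynomial `conj (z|η)`. -/
noncomputable def conjHermPoly {n : ℕ} (η : EuclideanSpace ℂ (Fin n)) : ConjPolynomial n :=
  ∑ j, C (η j) * X (Sum.inr j)

/-- The polynomial `|z|²`. -/
noncomputable def normSqPoly (n : ℕ) : ConjPolynomial n := ∑ j, X (Sum.inl j) * X (Sum.inr j)

theorem value_hermPoly {n : ℕ} (η z : EuclideanSpace ℂ (Fin n)) :
    (hermPoly η).value z = herm z η := by
  simp [ConjPolynomial.value, hermPoly, herm, mul_comm]

theorem value_conjHermPoly {n : ℕ} (η z : EuclideanSpace ℂ (Fin n)) :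
    (conjHermPoly η).value z = starRingEnd ℂ (herm z η) := by
  simp [ConjPolynomial.value, conjHermPoly, herm, mul_comm]

theorem herm_self {n : ℕ} (z : EuclideanSpace ℂ (Fin n)) : herm z z = (‖z‖ : ℂ) ^ 2 := by
  have : (‖z‖ : ℂ) ^ 2 = ((‖z‖ ^ 2 : ℝ) : ℂ) := by push_cast; rfl
  rw [this, EuclideanSpace.norm_sq_eq]
  simp [herm, Complex.mul_conj, Complex.normSq_eq_norm_sq]

theorem value_normSqPoly {n : ℕ} (z : EuclideanSpace ℂ (Fin n)) :
    (normSqPoly n).value z = herm z z := by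
  simp [ConjPolynomial.value, normSqPoly, herm]

theorem herm_smul {n : ℕ} (l : ℂ) (z η : EuclideanSpace ℂ (Fin n)) :
    herm (l • z) η = l * herm z η := by
  simp [herm, mul_sum, mul_assoc]

theorem pderiv_inl_hermPoly {n : ℕ} (η : EuclideanSpace ℂ (Fin n)) (j : Fin n) :
    pderiv (Sum.inl j) (hermPoly η) = C (starRingEnd ℂ (η j)) := by
  simp [hermPoly, pderiv_X, Pi.single_apply]

theorem pderiv_inr_hermPoly {n : ℕ} (η : EuclideanSpace ℂ (Fin n)) (j : Fin n) :
    pderiv (Sum.inr j) (hermPoly η) = 0 := by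
  simp [hermPoly, pderiv_X]

theorem pderiv_inl_conjHermPoly {n : ℕ} (η : EuclideanSpace ℂ (Fin n)) (j : Fin n) :
    pderiv (Sum.inl j) (conjHermPoly η) = 0 := by
  simp [conjHermPoly, pderiv_X]

theorem pderiv_inr_conjHermPoly {n : ℕ} (η : EuclideanSpace ℂ (Fin n)) (j : Fin n) :
    pderiv (Sum.inr j) (conjHermPoly η) = C (η j) := by
  simp [conjHermPoly, pderiv_X, Pi.single_apply]

theorem pderiv_inl_normSqPoly {n : ℕ} (j : Fin n) :
    pderiv (Sum.inl j) (normSqPoly n) = X (Sum.inr j) := by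
  simp [normSqPoly, pderiv_X, Pi.single_apply]

theorem pderiv_inr_normSqPoly {n : ℕ} (j : Fin n) :
    pderiv (Sum.inr j) (normSqPoly n) = X (Sum.inl j) := by
  simp [normSqPoly, pderiv_X, Pi.single_apply]

/-- The Laplacian preserves the algebra generated by `(z|η)`, its conjugate and `|z|²`. Truncated
exponents are harmless, since their coefficients vanish. -/
theorem laplacian_hermPoly_pow_mul {n : ℕ} {η : EuclideanSpace ℂ (Fin n)} (hη : ‖η‖ = 1)
    (a b i : ℕ) :
    laplacian n (hermPoly η ^ a * conjHermPoly η ^ b * normSqPoly n ^ i) =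
      C 4 * (((a * b : ℕ) : ConjPolynomial n) * hermPoly η ^ (a - 1) * conjHermPoly η ^ (b - 1) *
          normSqPoly n ^ i + ((i * (a + b + n + i - 1) : ℕ) : ConjPolynomial n) *
          (hermPoly η ^ a * conjHermPoly η ^ b * normSqPoly n ^ (i - 1))) := by
  have hηs : ∑ j, (C (η j) * C (starRingEnd ℂ (η j)) : ConjPolynomial n) = 1 := by
    have := herm_self η
    rw [hη] at this
    rw [← map_one (C (R := ℂ)), ← (by simpa using this : herm η η = 1), herm, map_sum]
    simp
  have hM : ∑ j, (C (η j) * X (Sum.inr j) : ConjPolynomial n) = conjHermPoly η := rfl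
  have hL : ∑ j, (C (starRingEnd ℂ (η j)) * X (Sum.inl j) : ConjPolynomial n) = hermPoly η := rfl
  have hR : ∑ j, (X (Sum.inl j) * X (Sum.inr j) : ConjPolynomial n) = normSqPoly n := rfl
  rw [laplacian_apply, ← C_mul']
  congr 1
  have hterm : ∀ j : Fin n, pderiv (Sum.inl j) (pderiv (Sum.inr j)
      (hermPoly η ^ a * conjHermPoly η ^ b * normSqPoly n ^ i)) =
      (C (η j) * C (starRingEnd ℂ (η j))) * (
        (a : ConjPolynomial n) * (b : ConjPolynomial n) * hermPoly η ^ (a - 1) *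
        conjHermPoly η ^ (b - 1) * normSqPoly n ^ i) +
      (C (η j) * X (Sum.inr j)) * (
        (b : ConjPolynomial n) * (i : ConjPolynomial n) * hermPoly η ^ a * conjHermPoly η ^ (b - 1) *
        normSqPoly n ^ (i - 1)) +
      (C (starRingEnd ℂ (η j)) * X (Sum.inl j)) * (
        (a : ConjPolynomial n) * (i : ConjPolynomial n) * hermPoly η ^ (a - 1) *
        conjHermPoly η ^ b * normSqPoly n ^ (i - 1)) +
      (i : ConjPolynomial n) * hermPoly η ^ a * conjHermPoly η ^ b * normSqPoly n ^ (i - 1) +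
      (X (Sum.inl j) * X (Sum.inr j)) * (
        (i : ConjPolynomial n) * ((i - 1 : ℕ) : ConjPolynomial n) * hermPoly η ^ a * conjHermPoly η ^ b *
        normSqPoly n ^ (i - 1 - 1)) := by
    intro j
    simp only [pderiv_mul, pderiv_pow, pderiv_inl_hermPoly, pderiv_inr_hermPoly,
      pderiv_inl_conjHermPoly, pderiv_inr_conjHermPoly, pderiv_inl_normSqPoly,
      pderiv_inr_normSqPoly, map_add, pderiv_C, pderiv_X_self, mul_zero, zero_mul, add_zero,
      zero_add, Derivation.map_natCast]
    ring
  simp only [hterm, sum_add_distrib, ← sum_mul, hηs, hM, hL, hR]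
  simp only [sum_const, card_univ, Fintype.card_fin, nsmul_eq_mul]
  rcases i with _ | _ | i <;> rcases a with _ | a <;> rcases b with _ | b <;>
    · simp only [Nat.add_sub_cancel, zero_add, add_zero, Nat.zero_sub, pow_zero,
        Nat.add_succ_sub_one]
      push_cast
      ring

end ComplexSphere

/-! ### The zonal harmonic polynomial -/

namespace ComplexSphere

open Finset MvPolynomial

/-- The bihomogeneous polynomial of bidegree `(p, q)` that restricts to the zonal kernel. -/
noncomputable def zonalPoly (M p q : ℕ) (η : EuclideanSpace ℂ (Fin (M + 2))) :
    ConjPolynomial (M + 2) :=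
  ∑ i ∈ range (min p q + 1), C (discCoeff M p q i : ℂ) *
    (hermPoly η ^ (p - i) * conjHermPoly η ^ (q - i) * normSqPoly (M + 2) ^ i)

theorem value_zonalPoly (M p q : ℕ) (η z : EuclideanSpace ℂ (Fin (M + 2))) :
    (zonalPoly M p q η).value z = ∑ i ∈ range (min p q + 1), (discCoeff M p q i : ℂ) *
      (herm z η ^ (p - i) * starRingEnd ℂ (herm z η) ^ (q - i) * herm z z ^ i) := by
  rw [← value_conjHermPoly, ← value_hermPoly, ← value_normSqPoly]
  simp [ConjPolynomial.value, zonalPoly]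

theorem zonalKernel_eq (M p q : ℕ) (η ξ : EuclideanSpace ℂ (Fin (M + 2))) :
    zonalKernel p q η ξ = discPolynomial M p q (herm ξ η) := by
  rw [zonalKernel]
  congr 1
  push_cast
  ring

theorem zonalKernel_eq_value (M p q : ℕ) (η ξ : EuclideanSpace ℂ (Fin (M + 2)))
    (hξ : ‖ξ‖ = 1) : zonalKernel p q η ξ = (zonalPoly M p q η).value ξ := by
  rw [zonalKernel_eq, discPolynomial_eq_sum, value_zonalPoly, herm_self, hξ]
  simp [mul_assoc]

theorem zonalPoly_mem_bihomogeneous (M p q : ℕ) (η : EuclideanSpace ℂ (Fin (M + 2))) :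
    zonalPoly M p q η ∈ bihomogeneous (M + 2) p q := by
  refine Submodule.sum_mem _ fun i hi => ?_
  rw [C_mul']
  refine Submodule.smul_mem _ _ fun l z => ?_
  have hi' : i ≤ p ∧ i ≤ q := by simpa [Nat.lt_succ_iff] using hi
  have key : ∀ z : EuclideanSpace ℂ (Fin (M + 2)), ConjPolynomial.value
      (hermPoly η ^ (p - i) * conjHermPoly η ^ (q - i) * normSqPoly (M + 2) ^ i) z =
      herm z η ^ (p - i) * starRingEnd ℂ (herm z η) ^ (q - i) * herm z z ^ i := by
    intro z
    rw [← value_conjHermPoly, ← value_hermPoly, ← value_normSqPoly]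
    simp [ConjPolynomial.value]
  have hself : herm (l • z) (l • z) = l * starRingEnd ℂ l * herm z z := by
    simp only [herm, PiLp.smul_apply, smul_eq_mul, map_mul, mul_sum]
    exact sum_congr rfl fun j _ => by ring
  rw [key, key, hself, herm_smul, map_mul]
  obtain ⟨a, rfl⟩ := Nat.exists_eq_add_of_le hi'.1
  obtain ⟨b, rfl⟩ := Nat.exists_eq_add_of_le hi'.2
  simp only [Nat.add_sub_cancel_left]
  ring

theorem laplacian_zonalPoly (M p q : ℕ) {η : EuclideanSpace ℂ (Fin (M + 2))} (hη : ‖η‖ = 1) :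
    laplacian (M + 2) (zonalPoly M p q η) = 0 := by
  rw [zonalPoly, map_sum]
  have hC : ∀ (a : ℂ) (P : ConjPolynomial (M + 2)),
      laplacian (M + 2) (C a * P) = C a * laplacian (M + 2) P := by
    intro a P
    rw [C_mul', C_mul', map_smul]
  simp only [hC, laplacian_hermPoly_pow_mul hη]
  simp only [mul_add (C 4 : ConjPolynomial (M + 2)),
    mul_add (C (_ : ℂ) : ConjPolynomial (M + 2)), sum_add_distrib]
  -- The two halves of the Laplacian are shifted by one index: the first loses its top term, where
  -- `p - i` or `q - i` is `0`, the second its term `i = 0`. Term `i` then cancels term `i + 1` by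
  -- `discCoeff_succ`.
  rw [sum_range_succ, sum_range_succ']
  have h1 : (((p - min p q) * (q - min p q) : ℕ) : ConjPolynomial (M + 2)) = 0 := by
    have : (p - min p q) * (q - min p q) = 0 := by
      rcases le_total p q with h | h <;> simp [h]
    rw [this, Nat.cast_zero]
  rw [h1]
  simp only [zero_mul, mul_zero, add_zero, Nat.cast_zero]
  rw [← sum_add_distrib]
  refine Finset.sum_eq_zero fun i hi => ?_
  have hi' : i < min p q := mem_range.1 hi
  have hip := (lt_min_iff.1 hi').1
  have hiq := (lt_min_iff.1 hi').2
  have h := congrArg (fun x : ℝ => (C (x : ℂ) : ConjPolynomial (M + 2))) (discCoeff_succ M p q i hi')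
  obtain ⟨a, rfl⟩ := Nat.exists_eq_add_of_lt hip
  obtain ⟨b, rfl⟩ := Nat.exists_eq_add_of_lt hiq
  rw [show i + a + 1 - i = a + 1 by omega, show i + b + 1 - i = b + 1 by omega,
    show i + a + 1 - (i + 1) = a by omega, show i + b + 1 - (i + 1) = b by omega,
    show a + b + (M + 2) + (i + 1) - 1 = a + b + M + i + 2 by omega, Nat.add_sub_cancel,
    Nat.add_sub_cancel, Nat.add_sub_cancel]
  push_cast at h ⊢
  simp only [map_add, map_sub, map_mul, map_neg, map_natCast, map_one] at h
  linear_combination (C 4 * (hermPoly η ^ a * conjHermPoly η ^ b * normSqPoly (M + 2) ^ i)) * h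

theorem zonalPoly_mem_solidHarmonics (M p q : ℕ) {η : EuclideanSpace ℂ (Fin (M + 2))}
    (hη : ‖η‖ = 1) : zonalPoly M p q η ∈ solidHarmonics (M + 2) p q :=
  ⟨laplacian_zonalPoly M p q hη, zonalPoly_mem_bihomogeneous M p q η⟩

/-! ### The Fischer inner product and the bound on the zonal kernel -/

/-- The Fischer inner product `⟨P, Q⟩ = ∑ d, d! P_d conj Q_d`, as a linear functional of `P`. -/
noncomputable def fischer {n : ℕ} (Q : ConjPolynomial n) : ConjPolynomial n →ₗ[ℂ] ℂ :=
  (basisMonomials (Fin n ⊕ Fin n) ℂ).constr ℂ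
    fun d => ((∏ i, (d i).factorial : ℕ) : ℂ) * starRingEnd ℂ (coeff d Q)

theorem fischer_monomial {n : ℕ} (Q : ConjPolynomial n) (d : Fin n ⊕ Fin n →₀ ℕ) (c : ℂ) :
    fischer Q (monomial d c) =
      c * (((∏ i, (d i).factorial : ℕ) : ℂ) * starRingEnd ℂ (coeff d Q)) := by
  have h : monomial d c = c • basisMonomials (Fin n ⊕ Fin n) ℂ d := by
    simp [smul_monomial]
  rw [h, map_smul, fischer, Module.Basis.constr_basis, smul_eq_mul]

theorem fischer_eq_sum {n : ℕ} (Q P : ConjPolynomial n) (S : Finset (Fin n ⊕ Fin n →₀ ℕ))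
    (hS : P.support ⊆ S) :
    fischer Q P = ∑ d ∈ S, ((∏ i, (d i).factorial : ℕ) : ℂ) *
      (coeff d P * starRingEnd ℂ (coeff d Q)) := by
  conv_lhs => rw [P.as_sum]
  rw [map_sum, sum_subset hS fun d _ hd => by
    rw [fischer_monomial, notMem_support_iff.1 hd, zero_mul]]
  exact sum_congr rfl fun d _ => by rw [fischer_monomial]; ring

theorem fischer_ext {n : ℕ} {f g : ConjPolynomial n →ₗ[ℂ] ℂ}
    (h : ∀ d c, f (monomial d c) = g (monomial d c)) : f = g := by
  refine LinearMap.ext fun P => ?_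
  rw [P.as_sum, map_sum, map_sum]
  exact sum_congr rfl fun d _ => h d _

theorem fischer_add {n : ℕ} (Q R P : ConjPolynomial n) :
    fischer (Q + R) P = fischer Q P + fischer R P := by
  rw [← LinearMap.add_apply]
  congr 1
  exact fischer_ext fun d c => by
    simp only [LinearMap.add_apply, fischer_monomial, coeff_add, map_add]; ring

theorem fischer_smul {n : ℕ} (a : ℂ) (Q P : ConjPolynomial n) :
    fischer (a • Q) P = starRingEnd ℂ a * fischer Q P := by
  rw [← smul_eq_mul, ← LinearMap.smul_apply]
  congr 1
  exact fischer_ext fun d c => by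
    simp only [LinearMap.smul_apply, fischer_monomial, coeff_smul, map_mul, smul_eq_mul]; ring

theorem fischer_sum {n : ℕ} {ι : Type*} (s : Finset ι) (Q : ι → ConjPolynomial n)
    (P : ConjPolynomial n) : fischer (∑ i ∈ s, Q i) P = ∑ i ∈ s, fischer (Q i) P := by
  classical
  induction s using Finset.induction_on with
  | empty =>
    have := fischer_smul (0 : ℂ) (0 : ConjPolynomial n) P
    simpa using this
  | insert i s hi ih => rw [sum_insert hi, sum_insert hi, fischer_add, ih]

/-- The weights `d!` are chosen so that multiplication by a variable is adjoint to the derivative in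
that variable. -/
theorem fischer_X_mul {n : ℕ} (i : Fin n ⊕ Fin n) (Q P : ConjPolynomial n) :
    fischer (X i * Q) P = fischer Q (pderiv i P) := by
  have : fischer (X i * Q) = fischer Q ∘ₗ (pderiv i).toLinearMap := by
    refine fischer_ext fun d c => ?_
    change _ = fischer Q (pderiv i (monomial d c))
    rw [pderiv_monomial, fischer_monomial, fischer_monomial, coeff_X_mul']
    split_ifs with h
    · have hd : d i ≠ 0 := Finsupp.mem_support_iff.1 h
      have hf : ∏ k, (d k).factorial =
          d i * ∏ k, ((d - Finsupp.single i 1 : Fin n ⊕ Fin n →₀ ℕ) k).factorial := by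
        rw [← mul_prod_erase _ _ (mem_univ i), ← mul_prod_erase univ (fun k => _) (mem_univ i),
          ← mul_assoc]
        congr 1
        · simp [Nat.mul_factorial_pred hd]
        · refine prod_congr rfl fun k hk => ?_
          simp [(ne_of_mem_erase hk).symm]
      rw [hf]
      push_cast
      ring
    · have hd : d i = 0 := by simpa using h
      simp [hd]
  rw [this]
  rfl

/-- Multiplication by `|z|²` is adjoint to a quarter of the Laplacian. -/
theorem fischer_normSqPoly_mul {n : ℕ} (Q : ConjPolynomial n) {P : ConjPolynomial n}
    (hP : laplacian n P = 0) : fischer (normSqPoly n * Q) P = 0 := by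
  have h : ∑ j, pderiv (Sum.inl j) (pderiv (Sum.inr j) P) = 0 := by
    rw [laplacian_apply] at hP
    exact (smul_eq_zero.1 hP).resolve_left (by norm_num)
  rw [normSqPoly, sum_mul, fischer_sum]
  have : ∀ j : Fin n, fischer (X (Sum.inl j) * X (Sum.inr j) * Q) P =
      fischer Q (pderiv (Sum.inl j) (pderiv (Sum.inr j) P)) := by
    intro j
    rw [mul_comm (X (Sum.inl j)), mul_assoc, fischer_X_mul, fischer_X_mul]
  simp only [this]
  rw [← map_sum, h, map_zero]

theorem fischer_hermPoly_mul {n : ℕ} (η : EuclideanSpace ℂ (Fin n)) (Q P : ConjPolynomial n) :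
    fischer (hermPoly η * Q) P = fischer Q (∑ j, C (η j) * pderiv (Sum.inl j) P) := by
  rw [hermPoly, sum_mul, fischer_sum, map_sum]
  refine sum_congr rfl fun j _ => ?_
  rw [mul_assoc, C_mul', C_mul', fischer_smul, fischer_X_mul, map_smul, smul_eq_mul,
    Complex.conj_conj]

theorem fischer_conjHermPoly_mul {n : ℕ} (η : EuclideanSpace ℂ (Fin n)) (Q P : ConjPolynomial n) :
    fischer (conjHermPoly η * Q) P =
      fischer Q (∑ j, C (starRingEnd ℂ (η j)) * pderiv (Sum.inr j) P) := by
  rw [conjHermPoly, sum_mul, fischer_sum, map_sum]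
  refine sum_congr rfl fun j _ => ?_
  rw [mul_assoc, C_mul', C_mul', fischer_smul, fischer_X_mul, map_smul, smul_eq_mul]

theorem sum_X_inl_mul_pderiv {n p q : ℕ} {P : ConjPolynomial n}
    (hP : P ∈ bihomogeneous n p q) : ∑ j, X (Sum.inl j) * pderiv (Sum.inl j) P = p • P := by
  rw [bihomogeneous_eq] at hP
  have h : P.IsWeightedHomogeneous (fun i => (bidegreeWeight n i).1) p := by
    intro d hd
    have := congrArg Prod.fst (hP hd)
    rw [weight_bidegreeWeight] at this
    rw [Finsupp.weight_apply, Finsupp.sum_fintype _ _ (by simp)]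
    simpa [bidegreeWeight] using this
  simpa [bidegreeWeight] using h.sum_weight_X_mul_pderiv

theorem sum_X_inr_mul_pderiv {n p q : ℕ} {P : ConjPolynomial n}
    (hP : P ∈ bihomogeneous n p q) : ∑ j, X (Sum.inr j) * pderiv (Sum.inr j) P = q • P := by
  rw [bihomogeneous_eq] at hP
  have h : P.IsWeightedHomogeneous (fun i => (bidegreeWeight n i).2) q := by
    intro d hd
    have := congrArg Prod.snd (hP hd)
    rw [weight_bidegreeWeight] at this
    rw [Finsupp.weight_apply, Finsupp.sum_fintype _ _ (by simp)]
    simpa [bidegreeWeight] using this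
  simpa [bidegreeWeight] using h.sum_weight_X_mul_pderiv

/-- Each factor moves across as a derivative in the direction `η` or `η̄`; evaluated at `η`, that
derivative is the degree times the value by Euler's identity. -/
theorem fischer_hermPoly_pow {n : ℕ} (η : EuclideanSpace ℂ (Fin n)) {p q : ℕ}
    {P : ConjPolynomial n} (hP : P ∈ bihomogeneous n p q) :
    fischer (hermPoly η ^ p * conjHermPoly η ^ q) P =
      (p.factorial * q.factorial : ℕ) * P.value η := by
  induction p generalizing P with
  | zero =>
    induction q generalizing P with
    | zero =>
      have h0 : P = C (coeff 0 P) := by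
        rw [bihomogeneous_eq] at hP
        ext d
        rw [coeff_C]
        split_ifs with h
        · rw [← h]
        · by_contra hd
          apply h
          have := hP hd
          rw [weight_bidegreeWeight, Prod.mk.injEq] at this
          ext i
          rcases i with i | i
          · exact ((Finset.sum_eq_zero_iff.1 this.1) i (mem_univ i)).symm
          · exact ((Finset.sum_eq_zero_iff.1 this.2) i (mem_univ i)).symm
      rw [h0, ← monomial_zero', fischer_monomial]
      simp [ConjPolynomial.value]
    | succ q ih =>
      have hmem : ∑ j, C (starRingEnd ℂ (η j)) * pderiv (Sum.inr j) P ∈ bihomogeneous n 0 q := by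
        rw [bihomogeneous_eq] at hP ⊢
        refine Submodule.sum_mem _ fun j _ => ?_
        rw [C_mul']
        exact Submodule.smul_mem _ _ (IsWeightedHomogeneous.pderiv hP (by simp [bidegreeWeight]))
      have h := ih hmem
      have hE := congrArg (fun P => ConjPolynomial.value P η) (sum_X_inr_mul_pderiv hP)
      have hv : ConjPolynomial.value (∑ j, C (starRingEnd ℂ (η j)) * pderiv (Sum.inr j) P) η =
          (q + 1) * P.value η := by
        simpa [ConjPolynomial.value] using hE
      rw [pow_succ', mul_left_comm, fischer_conjHermPoly_mul, h, hv, Nat.factorial_succ]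
      push_cast
      ring
  | succ p ih =>
    have hmem : ∑ j, C (η j) * pderiv (Sum.inl j) P ∈ bihomogeneous n p q := by
      rw [bihomogeneous_eq] at hP ⊢
      refine Submodule.sum_mem _ fun j _ => ?_
      rw [C_mul']
      exact Submodule.smul_mem _ _ (IsWeightedHomogeneous.pderiv hP (by simp [bidegreeWeight]))
    have h := ih hmem
    have hE := congrArg (fun P => ConjPolynomial.value P η) (sum_X_inl_mul_pderiv hP)
    have hv : ConjPolynomial.value (∑ j, C (η j) * pderiv (Sum.inl j) P) η =
        (p + 1) * P.value η := by
      simpa [ConjPolynomial.value] using hE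
    rw [pow_succ', mul_assoc, fischer_hermPoly_mul, h, hv, Nat.factorial_succ]
    push_cast
    ring

/-- Reproducing property: modulo multiples of `|z|²`, which are orthogonal to harmonic polynomials,
only the leading term of the zonal polynomial remains. -/
theorem fischer_zonalPoly (M p q : ℕ) (η : EuclideanSpace ℂ (Fin (M + 2)))
    {P : ConjPolynomial (M + 2)} (hP : P ∈ solidHarmonics (M + 2) p q) :
    fischer (zonalPoly M p q η) P =
      ((discCoeff M p q 0 * (p.factorial * q.factorial) : ℝ) : ℂ) * P.value η := by
  rw [zonalPoly, fischer_sum, sum_range_succ', Finset.sum_eq_zero, zero_add, C_mul', fischer_smul]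
  · simp only [pow_zero, mul_one, Nat.sub_zero]
    rw [fischer_hermPoly_pow η hP.2, Complex.conj_ofReal]
    push_cast
    ring
  · intro i _
    rw [C_mul', fischer_smul, pow_succ, ← mul_assoc, mul_comm _ (normSqPoly (M + 2)),
      fischer_normSqPoly_mul _ hP.1, mul_zero]

theorem norm_fischer_sq_le {n : ℕ} (P Q : ConjPolynomial n) :
    ‖fischer Q P‖ ^ 2 ≤ ‖fischer P P‖ * ‖fischer Q Q‖ := by
  classical
  have hself : ∀ (P : ConjPolynomial n) (S : Finset _), P.support ⊆ S → ‖fischer P P‖ =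
      ∑ d ∈ S, (√(∏ i, (d i).factorial : ℕ) * ‖coeff d P‖) ^ 2 := by
    intro P S hS
    have : fischer P P =
        ((∑ d ∈ S, (√(∏ i, (d i).factorial : ℕ) * ‖coeff d P‖) ^ 2 : ℝ) : ℂ) := by
      rw [fischer_eq_sum P P S hS]
      push_cast
      refine sum_congr rfl fun d _ => ?_
      rw [Complex.mul_conj, Complex.normSq_eq_norm_sq, mul_pow]
      norm_cast
      rw [Real.sq_sqrt (by positivity)]
    rw [this, Complex.norm_real, Real.norm_of_nonneg (sum_nonneg fun d _ => sq_nonneg _)]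
  rw [hself P (P.support ∪ Q.support) subset_union_left,
    hself Q (P.support ∪ Q.support) subset_union_right]
  refine le_trans ?_ (sum_mul_sq_le_sq_mul_sq _ _ _)
  gcongr
  rw [fischer_eq_sum Q P _ subset_union_left]
  refine (norm_sum_le _ _).trans (sum_le_sum fun d _ => le_of_eq ?_)
  rw [norm_mul, norm_mul, RCLike.norm_conj, Complex.norm_natCast]
  have := Real.mul_self_sqrt (Nat.cast_nonneg (α := ℝ) (∏ i, (d i).factorial))
  nth_rw 1 [← this]
  ring

theorem zonalKernel_self (M p q : ℕ) {η : EuclideanSpace ℂ (Fin (M + 2))} (hη : ‖η‖ = 1) :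
    zonalKernel p q η η = 1 := by
  rw [zonalKernel_eq, herm_self, hη]
  simpa using discPolynomial_one M p q

/-- The zonal kernel is bounded by its value on the diagonal. -/
theorem norm_zonalKernel_le_one (M p q : ℕ) {η ξ : EuclideanSpace ℂ (Fin (M + 2))}
    (hη : ‖η‖ = 1) (hξ : ‖ξ‖ = 1) : ‖zonalKernel p q η ξ‖ ≤ 1 := by
  have hk : 0 < discCoeff M p q 0 * (p.factorial * q.factorial : ℝ) :=
    mul_pos (discCoeff_zero_pos M p q) (by positivity)
  set k := discCoeff M p q 0 * (p.factorial * q.factorial : ℝ)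
  have hself : ∀ {η : EuclideanSpace ℂ (Fin (M + 2))}, ‖η‖ = 1 →
      ‖fischer (zonalPoly M p q η) (zonalPoly M p q η)‖ = k := by
    intro η hη
    rw [fischer_zonalPoly M p q η (zonalPoly_mem_solidHarmonics M p q hη),
      ← zonalKernel_eq_value M p q η η hη, zonalKernel_self M p q hη, mul_one, Complex.norm_real,
      Real.norm_of_nonneg hk.le]
  -- By the reproducing property the inner product is `k Z_η(ξ)` and both squared norms are `k`, so
  -- Cauchy–Schwarz reads `(k |Z|)² ≤ k²`.
  have h := norm_fischer_sq_le (zonalPoly M p q η) (zonalPoly M p q ξ)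
  rw [hself hη, hself hξ, fischer_zonalPoly M p q ξ (zonalPoly_mem_solidHarmonics M p q hη),
    ← zonalKernel_eq_value M p q η ξ hξ, norm_mul, Complex.norm_real,
    Real.norm_of_nonneg hk.le, ← sq] at h
  have h2 := le_of_sq_le_sq h hk.le
  exact (mul_le_iff_le_one_right hk).1 h2

end ComplexSphere

/-! ### Comparison of the two triple series -/

namespace ComplexSphere

open Finset

/-- Sums over the finite fibres of `((a, b), k) ↦ (a + k, b + k)`; applied to both triple series, it
makes them comparable term by term. -/
theorem hasSum_regroup {f : (ℕ × ℕ) × ℕ → ℂ} {s : ℂ} (hf : HasSum f s) :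
    HasSum (fun x : ℕ × ℕ => ∑ k ∈ range (min x.1 x.2 + 1), f ((x.1 - k, x.2 - k), k)) s := by
  let e : (ℕ × ℕ) × ℕ → (ℕ × ℕ) × ℕ := fun x => ((x.1.1 + x.2, x.1.2 + x.2), x.2)
  have he : Function.Injective e := by
    rintro ⟨⟨a, b⟩, k⟩ ⟨⟨a', b'⟩, k'⟩ h
    simp only [e, Prod.mk.injEq] at h
    obtain ⟨⟨h1, h2⟩, h3⟩ := h
    ext <;> simp <;> omega
  let h : (ℕ × ℕ) × ℕ → ℂ := fun x =>
    if x.2 ≤ min x.1.1 x.1.2 then f ((x.1.1 - x.2, x.1.2 - x.2), x.2) else 0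
  have hhe : h ∘ e = f := by
    funext ⟨⟨a, b⟩, k⟩
    simp [h, e]
  have hh : HasSum h s := by
    rw [← he.hasSum_iff, hhe]
    · exact hf
    · rintro ⟨⟨u, v⟩, k⟩ hx
      apply if_neg
      intro hk
      simp only [le_min_iff] at hk
      exact hx ⟨((u - k, v - k), k), by simp [e, hk.1, hk.2]⟩
  refine hh.prod_fiberwise fun x => ?_
  have hx : ∀ k ∈ range (min x.1 x.2 + 1), f ((x.1 - k, x.2 - k), k) = h (x, k) := by
    intro k hk
    have : k ≤ min x.1 x.2 := by simpa [Nat.lt_succ_iff] using hk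
    exact (if_pos this).symm
  rw [sum_congr rfl hx]
  refine hasSum_sum_of_ne_finset_zero fun k hk => if_neg ?_
  simpa [Nat.lt_succ_iff] using hk

theorem sum_range_sum_range_sub (μ : ℕ) (g : ℕ → ℕ → ℂ) :
    ∑ k ∈ range (μ + 1), ∑ i ∈ range (μ - k + 1), g k i =
      ∑ m ∈ range (μ + 1), ∑ i ∈ range (m + 1), g (m - i) i := by
  rw [sum_sigma', sum_sigma']
  refine sum_nbij' (fun x => ⟨x.1 + x.2, x.2⟩) (fun x => ⟨x.1 - x.2, x.2⟩) ?_ ?_ ?_ ?_ ?_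
  · rintro ⟨k, i⟩ h
    simp only [mem_sigma, mem_range] at h ⊢
    omega
  · rintro ⟨k, i⟩ h
    simp only [mem_sigma, mem_range] at h ⊢
    omega
  · rintro ⟨k, i⟩ h
    simp
  · rintro ⟨k, i⟩ h
    simp only [mem_sigma, mem_range] at h
    simp only [Sigma.mk.injEq, heq_eq_eq, and_true]
    omega
  · rintro ⟨k, i⟩ h
    simp

theorem choose_mul_factorial (M a : ℕ) :
    ((a + (M + 1)).choose (M + 1) : ℝ) =
      (M + 1 + a).factorial / (a.factorial * (M + 1).factorial) := by
  rw [← Nat.choose_symm_add, Nat.cast_add_choose, add_comm a (M + 1)]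

/-- The contribution of `(p, q, k) = (a+i, b+i, m-i)` to `w^a w̄^b` is, up to a factor free of `i`,
the `i`-th term of the very well poised `₅F₄`. The dimension supplies the factor linear in `i`. -/
theorem finrank_mul_szegoTerm_mul_discCoeff (M a b m i : ℕ) (hi : i ≤ m) (r : ℝ) :
    (Module.finrank ℂ (solidHarmonics (M + 2) (a + i) (b + i)) : ℝ) *
      szegoTerm (M + 2) (a + i) (b + i) r (m - i) * discCoeff M (a + i) (b + i) i =
    r ^ (a + b + 2 * m) * ((a + (M + 1)).choose (M + 1) * (b + (M + 1)).choose (M + 1)) *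
      ((-1) ^ i * ((a : ℝ) + b + (M + 2 : ℕ) - 1 + 2 * i) * poch (a + (M + 2 : ℕ)) i *
        poch (b + (M + 2 : ℕ)) i * poch (a + i) (m - i) * poch (b + i) (m - i) /
        (i.factorial * (m - i).factorial *
          poch (a + b + (M + 2 : ℕ) - 1 + i) (m + 1))) := by
  obtain ⟨k, rfl⟩ := Nat.exists_eq_add_of_le hi
  have h1 := factorial_mul_poch (a + M + 1) i
  have h2 := factorial_mul_poch (b + M + 1) i
  have h3 := factorial_mul_poch (a + b + M + i) (i + k + 1)
  have e1 : (a : ℝ) + (M + 2 : ℕ) = (a + M + 1 : ℕ) + 1 := by push_cast; ring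
  have e2 : (b : ℝ) + (M + 2 : ℕ) = (b + M + 1 : ℕ) + 1 := by push_cast; ring
  have e3 : (a : ℝ) + b + (M + 2 : ℕ) - 1 + i = (a + b + M + i : ℕ) + 1 := by push_cast; ring
  have hD : 0 < poch ((a + b + M + i : ℕ) + 1 : ℝ) (i + k + 1) := poch_pos (by positivity) _
  rw [finrank_solidHarmonics, discCoeff_eq, choose_mul_factorial, choose_mul_factorial, szegoTerm,
    e1, e2, e3, Nat.add_sub_cancel_left,
    show a + i + (M + 2) - 1 = a + M + 1 + i by omega,
    show b + i + (M + 2) - 1 = b + M + 1 + i by omega,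
    show M + 2 - 1 + (a + i) + (b + i) + k = a + b + M + i + (i + k + 1) by omega,
    ← h1, ← h2, ← h3, show M + 2 - 1 = M + 1 by omega, show M + a + b + i = a + b + M + i by ring,
    show M + 1 + a = a + M + 1 by ring, show M + 1 + b = b + M + 1 by ring,
    show a + i + M = M + a + i by ring, show b + i + M = M + b + i by ring]
  generalize poch ((a + b + M + i : ℕ) + 1 : ℝ) (i + k + 1) = D at *
  generalize poch ((a + M + 1 : ℕ) + 1 : ℝ) i = E
  generalize poch ((b + M + 1 : ℕ) + 1 : ℝ) i = F
  have hpos : ∀ n : ℕ, (n.factorial : ℝ) ≠ 0 := fun n => by positivity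
  push_cast
  field_simp
  ring

theorem sum_finrank_mul_szegoTerm_mul_discCoeff (M a b m : ℕ) (r : ℝ) :
    ∑ i ∈ range (m + 1), (Module.finrank ℂ (solidHarmonics (M + 2) (a + i) (b + i)) : ℝ) *
      szegoTerm (M + 2) (a + i) (b + i) r (m - i) * discCoeff M (a + i) (b + i) i =
    r ^ (a + b + 2 * m) * ((a + (M + 1)).choose (M + 1) * (b + (M + 1)).choose (M + 1)) *
      ((-1) ^ m * (M + 2).choose m) := by
  rw [sum_congr rfl fun i hi => finrank_mul_szegoTerm_mul_discCoeff M a b m i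
    (Nat.lt_succ_iff.1 (mem_range.1 hi)) r, ← mul_sum, sum_range_wellPoised _ _ _
    (by push_cast; linarith [(by positivity : (0 : ℝ) < (a : ℝ) + b + M + 1)]),
    poch_neg_natCast, Nat.descFactorial_eq_factorial_mul_choose]
  congr 1
  have : (m.factorial : ℝ) ≠ 0 := by positivity
  push_cast
  field_simp

/-- Disc polynomials are expanded only inside a finite fibre, so the fourfold series need not be
summable. Setting `m = k + i` collects equal powers of `w` and `w̄`. -/
theorem sum_fiber_eq (M u v : ℕ) (r : ℝ) (w : ℂ) :
    ∑ k ∈ range (min u v + 1),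
      (Module.finrank ℂ (solidHarmonics (M + 2) (u - k) (v - k)) : ℂ) *
        (szegoTerm (M + 2) (u - k) (v - k) r k : ℂ) * discPolynomial M (u - k) (v - k) w =
    ∑ m ∈ range (min u v + 1),
      (((u - m + (M + 1)).choose (M + 1) : ℂ) * (r * w) ^ (u - m) *
        (((v - m + (M + 1)).choose (M + 1) : ℂ) * (r * starRingEnd ℂ w) ^ (v - m))) *
        ((-1) ^ m * (M + 2).choose m * (r : ℂ) ^ (2 * m)) := by
  have h1 : ∀ k ∈ range (min u v + 1),
      (Module.finrank ℂ (solidHarmonics (M + 2) (u - k) (v - k)) : ℂ) *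
        (szegoTerm (M + 2) (u - k) (v - k) r k : ℂ) * discPolynomial M (u - k) (v - k) w =
      ∑ i ∈ range (min u v - k + 1),
        (Module.finrank ℂ (solidHarmonics (M + 2) (u - k) (v - k)) : ℂ) *
        (szegoTerm (M + 2) (u - k) (v - k) r k : ℂ) * ((discCoeff M (u - k) (v - k) i : ℂ) *
          w ^ (u - k - i) * (starRingEnd ℂ w) ^ (v - k - i)) := by
    intro k hk
    rw [discPolynomial_eq_sum, mul_sum, show min (u - k) (v - k) = min u v - k by omega]
  rw [sum_congr rfl h1, sum_range_sum_range_sub]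
  refine sum_congr rfl fun m hm => ?_
  have hm' : m ≤ u ∧ m ≤ v := by simpa [Nat.lt_succ_iff] using hm
  obtain ⟨a, rfl⟩ := Nat.exists_eq_add_of_le hm'.1
  obtain ⟨b, rfl⟩ := Nat.exists_eq_add_of_le hm'.2
  have h2 := congrArg (fun x : ℝ => (x : ℂ) * (w ^ a * (starRingEnd ℂ w) ^ b))
    (sum_finrank_mul_szegoTerm_mul_discCoeff M a b m r)
  simp only [Nat.add_sub_cancel_left] at h2 ⊢
  rw [Complex.ofReal_sum, sum_mul] at h2
  refine Eq.trans (sum_congr rfl fun i hi => ?_) (h2.trans ?_)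
  · have him : i ≤ m := Nat.lt_succ_iff.1 (mem_range.1 hi)
    rw [show m + a - (m - i) = a + i by omega, show m + b - (m - i) = b + i by omega,
      Nat.add_sub_cancel, Nat.add_sub_cancel]
    push_cast
    ring
  · push_cast
    ring

theorem poissonSzego_eq_mul (M : ℕ) (r : ℝ) (w : ℂ) :
    (((1 - r ^ 2) ^ (M + 2) / ‖1 - (r : ℂ) * w‖ ^ (2 * (M + 2)) : ℝ) : ℂ) =
      1 / (1 - (r : ℂ) * w) ^ (M + 1 + 1) * (1 / (1 - (r : ℂ) * starRingEnd ℂ w) ^ (M + 1 + 1)) *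
        (1 - (r : ℂ) ^ 2) ^ (M + 2) := by
  have hn : ((‖1 - (r : ℂ) * w‖ : ℂ)) ^ 2 = (1 - r * w) * (1 - r * starRingEnd ℂ w) := by
    rw [← Complex.mul_conj']
    simp
  rw [Complex.ofReal_div, Complex.ofReal_pow, Complex.ofReal_pow, pow_mul, hn, mul_pow]
  push_cast
  rw [div_mul_div_comm, one_mul, div_mul_eq_mul_div, one_mul]

theorem hasSum_mul_complex {ι κ : Type*} {f : ι → ℂ} {g : κ → ℂ} {s t : ℂ} (hf : HasSum f s)
    (hg : HasSum g t) : HasSum (fun x : ι × κ => f x.1 * g x.2) (s * t) :=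
  hf.mul hg (summable_mul_of_summable_norm hf.summable.norm hg.summable.norm)

theorem hasSum_poissonSzego (M : ℕ) {r : ℝ} (hr0 : 0 ≤ r) (hr1 : r < 1) {w : ℂ} (hw : ‖w‖ ≤ 1) :
    HasSum (fun x : (ℕ × ℕ) × ℕ =>
      (((x.1.1 + (M + 1)).choose (M + 1) : ℂ) * (r * w) ^ x.1.1 *
        (((x.1.2 + (M + 1)).choose (M + 1) : ℂ) * (r * starRingEnd ℂ w) ^ x.1.2)) *
        ((-1) ^ x.2 * (M + 2).choose x.2 * (r : ℂ) ^ (2 * x.2)))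
      (((1 - r ^ 2) ^ (M + 2) / ‖1 - (r : ℂ) * w‖ ^ (2 * (M + 2)) : ℝ) : ℂ) := by
  have hrw : ‖(r : ℂ) * w‖ < 1 := by
    rw [norm_mul, Complex.norm_real, Real.norm_of_nonneg hr0]
    nlinarith [norm_nonneg w]
  have hrw' : ‖(r : ℂ) * starRingEnd ℂ w‖ < 1 := by
    rwa [norm_mul, RCLike.norm_conj, ← norm_mul]
  have h1 : HasSum (fun a : ℕ => ((a + (M + 1)).choose (M + 1) : ℂ) * (r * w) ^ a)
      (1 / (1 - (r : ℂ) * w) ^ (M + 1 + 1)) :=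
    hasSum_choose_mul_geometric_of_norm_lt_one (M + 1) hrw
  have h2 : HasSum
      (fun a : ℕ => ((a + (M + 1)).choose (M + 1) : ℂ) * (r * starRingEnd ℂ w) ^ a)
      (1 / (1 - (r : ℂ) * starRingEnd ℂ w) ^ (M + 1 + 1)) :=
    hasSum_choose_mul_geometric_of_norm_lt_one (M + 1) hrw'
  have h3 : HasSum (fun m : ℕ => (-1 : ℂ) ^ m * (M + 2).choose m * (r : ℂ) ^ (2 * m))
      ((1 - (r : ℂ) ^ 2) ^ (M + 2)) := by
    have : (1 - (r : ℂ) ^ 2) ^ (M + 2) = ∑ m ∈ range (M + 2 + 1),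
        (-1 : ℂ) ^ m * (M + 2).choose m * (r : ℂ) ^ (2 * m) := by
      rw [sub_eq_neg_add, add_pow]
      refine sum_congr rfl fun m _ => ?_
      rw [neg_pow, pow_mul]
      ring
    rw [this]
    refine hasSum_sum_of_ne_finset_zero fun m hm => ?_
    rw [Nat.choose_eq_zero_of_lt (by simpa using hm)]
    simp
  rw [poissonSzego_eq_mul M r w]
  have h12 := hasSum_mul_complex h1 h2
  have h123 := hasSum_mul_complex h12 h3
  exact h123

theorem norm_herm_le_one {n : ℕ} {ξ η : EuclideanSpace ℂ (Fin n)} (hξ : ‖ξ‖ = 1) (hη : ‖η‖ = 1) :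
    ‖herm ξ η‖ ≤ 1 := by
  have h : herm ξ η = inner ℂ η ξ := by
    simp [herm, PiLp.inner_apply]
  rw [h]
  simpa [hξ, hη] using norm_inner_le_norm (𝕜 := ℂ) η ξ

theorem finrank_mul_szegoCoeff_le (M p q : ℕ) {r : ℝ} (hr0 : 0 ≤ r) (hr1 : r < 1) :
    (Module.finrank ℂ (solidHarmonics (M + 2) p q) : ℝ) * szegoCoeff (M + 2) p q r ≤
      ((p + (M + 1)).choose (M + 1) * r ^ p) * ((q + (M + 1)).choose (M + 1) * r ^ q) := by
  have hm : ∀ p : ℕ, (M + 2).multichoose p = (p + (M + 1)).choose (M + 1) := by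
    intro p
    rw [Nat.multichoose_eq, show M + 2 + p - 1 = p + (M + 1) by omega, Nat.choose_symm_add]
  have h1 : (Module.finrank ℂ (solidHarmonics (M + 2) p q) : ℝ) ≤
      (p + (M + 1)).choose (M + 1) * (q + (M + 1)).choose (M + 1) := by
    rw [← hm, ← hm]
    exact_mod_cast finrank_solidHarmonics_le (M + 2) p q
  calc _ ≤ ((p + (M + 1)).choose (M + 1) * (q + (M + 1)).choose (M + 1) : ℝ) * r ^ (p + q) := by
        gcongr
        · exact szegoCoeff_nonneg _ _ _ hr0
        · exact szegoCoeff_le (M + 1) p q hr0 hr1.le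
    _ = _ := by rw [pow_add]; ring

theorem summable_choose_mul_pow_mul (M : ℕ) {r : ℝ} (hr0 : 0 ≤ r) (hr1 : r < 1) :
    Summable fun x : ℕ × ℕ => ((x.1 + (M + 1)).choose (M + 1) * r ^ x.1) *
      ((x.2 + (M + 1)).choose (M + 1) * r ^ x.2) := by
  have h := summable_choose_mul_geometric_of_norm_lt_one (M + 1)
    (by rwa [Real.norm_of_nonneg hr0] : ‖r‖ < 1)
  exact h.mul_of_nonneg h (fun _ => by positivity) fun _ => by positivity

theorem norm_term_le (M p q : ℕ) {r : ℝ} (hr0 : 0 ≤ r) (hr1 : r < 1) {z : ℂ} (hz : ‖z‖ ≤ 1) :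
    ‖(Module.finrank ℂ (solidHarmonics (M + 2) p q) : ℂ) * (szegoCoeff (M + 2) p q r : ℂ) * z‖ ≤
      ((p + (M + 1)).choose (M + 1) * r ^ p) * ((q + (M + 1)).choose (M + 1) * r ^ q) := by
  have h0 := szegoCoeff_nonneg (M + 2) p q hr0
  refine le_trans ?_ (finrank_mul_szegoCoeff_le M p q hr0 hr1)
  rw [norm_mul, norm_mul, Complex.norm_natCast, Complex.norm_real, Real.norm_of_nonneg h0]
  exact mul_le_of_le_one_right (by positivity) hz

theorem hasSum_zonal_expansion (M : ℕ) {r : ℝ} (hr0 : 0 ≤ r) (hr1 : r < 1) {w : ℂ}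
    (hw : ‖w‖ ≤ 1) (hZ : ∀ p q, ‖discPolynomial M p q w‖ ≤ 1) :
    HasSum (fun x : ℕ × ℕ => (Module.finrank ℂ (solidHarmonics (M + 2) x.1 x.2) : ℂ) *
        (szegoCoeff (M + 2) x.1 x.2 r : ℂ) * discPolynomial M x.1 x.2 w)
      (((1 - r ^ 2) ^ (M + 2) / ‖1 - (r : ℂ) * w‖ ^ (2 * (M + 2)) : ℝ) : ℂ) := by
  let f : (ℕ × ℕ) × ℕ → ℂ := fun x =>
    (Module.finrank ℂ (solidHarmonics (M + 2) x.1.1 x.1.2) : ℂ) *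
      (szegoTerm (M + 2) x.1.1 x.1.2 r x.2 : ℂ) * discPolynomial M x.1.1 x.1.2 w
  have hS : ∀ p q, HasSum (szegoTerm (M + 2) p q r) (szegoCoeff (M + 2) p q r) := fun p q =>
    (summable_szegoTerm (M + 1) p q hr0 hr1.le).hasSum
  have hnorm : ∀ x : ℕ × ℕ, HasSum (fun k => ‖f (x, k)‖)
      ‖(Module.finrank ℂ (solidHarmonics (M + 2) x.1 x.2) : ℂ) *
        (szegoCoeff (M + 2) x.1 x.2 r : ℂ) * discPolynomial M x.1 x.2 w‖ := by
    intro x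
    simp only [f, norm_mul, Complex.norm_natCast, Complex.norm_real,
      Real.norm_of_nonneg (szegoTerm_nonneg _ _ _ hr0 _),
      Real.norm_of_nonneg (szegoCoeff_nonneg _ _ _ hr0)]
    exact ((hS x.1 x.2).mul_left _).mul_right _
  -- The Szegő terms are nonnegative, so summing norms over `k` gives the norm of the full `(p, q)`
  -- term, which has a summable majorant.
  have hf : Summable f := by
    refine Summable.of_norm ((summable_prod_of_nonneg fun x => norm_nonneg _).2
      ⟨fun x => (hnorm x).summable, ?_⟩)
    refine (summable_choose_mul_pow_mul M hr0 hr1).of_nonneg_of_le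
      (fun x => tsum_nonneg fun _ => norm_nonneg _) fun x => ?_
    rw [(hnorm x).tsum_eq]
    exact norm_term_le M x.1 x.2 hr0 hr1 (hZ x.1 x.2)
  have h1 := hf.hasSum.prod_fiberwise (fun x : ℕ × ℕ =>
    ((Complex.hasSum_ofReal.2 (hS x.1 x.2)).mul_left
      (Module.finrank ℂ (solidHarmonics (M + 2) x.1 x.2) : ℂ)).mul_right
        (discPolynomial M x.1 x.2 w))
  have h2 := hasSum_regroup hf.hasSum
  have h3 := hasSum_regroup (hasSum_poissonSzego M hr0 hr1 hw)
  have h4 : (fun x : ℕ × ℕ => ∑ k ∈ range (min x.1 x.2 + 1), f ((x.1 - k, x.2 - k), k)) = _ :=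
    funext fun x => sum_fiber_eq M x.1 x.2 r w
  rw [h4] at h2
  -- After regrouping, both triple series are the same double series, so their sums agree.
  rwa [h2.unique h3] at h1

end ComplexSphere

theorem mainTheorem2 (n : ℕ) (hn : 2 ≤ n) (r : ℝ) (hr0 : 0 ≤ r) (hr1 : r < 1)
    (η : EuclideanSpace ℂ (Fin n)) (hη : η ∈ Metric.sphere (0 : EuclideanSpace ℂ (Fin n)) 1) :
    -- the kernel on the sphere of radius `r`, and its absolutely convergent expansion
    (∀ ξ ∈ Metric.sphere (0 : EuclideanSpace ℂ (Fin n)) 1,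
      ComplexSphere.poissonSzego ((r : ℂ) • ξ) η =
          (1 - r ^ 2) ^ n / ‖1 - (r : ℂ) * ComplexSphere.herm ξ η‖ ^ (2 * n) ∧
        HasSum
          (fun pq : ℕ × ℕ =>
            (Module.finrank ℂ (ComplexSphere.solidHarmonics n pq.1 pq.2) : ℂ) *
              (ComplexSphere.szegoCoeff n pq.1 pq.2 r : ℂ) *
              ComplexSphere.zonalKernel pq.1 pq.2 η ξ)
          (ComplexSphere.poissonSzego ((r : ℂ) • ξ) η : ℂ)) ∧
    -- the convergence is uniform on the sphere
    HasSumUniformlyOn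
      (fun (pq : ℕ × ℕ) (ξ : EuclideanSpace ℂ (Fin n)) =>
        (Module.finrank ℂ (ComplexSphere.solidHarmonics n pq.1 pq.2) : ℂ) *
          (ComplexSphere.szegoCoeff n pq.1 pq.2 r : ℂ) *
          ComplexSphere.zonalKernel pq.1 pq.2 η ξ)
      (fun ξ => (ComplexSphere.poissonSzego ((r : ℂ) • ξ) η : ℂ))
      (Metric.sphere (0 : EuclideanSpace ℂ (Fin n)) 1) ∧
    -- it is a spherical harmonic expansion
    (∀ p q : ℕ, ∃ Q ∈ ComplexSphere.solidHarmonics n p q,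
      ∀ ξ ∈ Metric.sphere (0 : EuclideanSpace ℂ (Fin n)) 1,
        ComplexSphere.zonalKernel p q η ξ = Q.value ξ) ∧
    -- the series for the coefficients converges
    (∀ p q : ℕ, Summable (ComplexSphere.szegoTerm n p q r)) ∧
    -- its form with factorials, for positive `p` and `q`
    (∀ p q : ℕ, 1 ≤ p → 1 ≤ q →
      HasSum
        (fun k : ℕ =>
          r ^ (p + q) *
            (((p + n - 1).factorial * (q + n - 1).factorial : ℝ) /
              ((n - 1).factorial * (p - 1).factorial * (q - 1).factorial)) *
            (((p + k - 1).factorial * (q + k - 1).factorial : ℝ) /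
              (n - 1 + p + q + k).factorial * (r ^ (2 * k) / k.factorial)))
        (ComplexSphere.szegoCoeff n p q r)) ∧
    -- its hypergeometric form; the series at `1` in the denominator converges to a positive sum
    (∀ p q : ℕ,
      HasSum (fun k : ℕ => ordinaryHypergeometricCoefficient (p : ℝ) (q : ℝ) ((p : ℝ) + q + n) k)
          (ordinaryHypergeometric (p : ℝ) (q : ℝ) ((p : ℝ) + q + n) (1 : ℝ)) ∧
        0 < ordinaryHypergeometric (p : ℝ) (q : ℝ) ((p : ℝ) + q + n) (1 : ℝ) ∧
        ComplexSphere.szegoCoeff n p q r =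
          r ^ (p + q) *
            ordinaryHypergeometric (p : ℝ) (q : ℝ) ((p : ℝ) + q + n) (r ^ 2) /
            ordinaryHypergeometric (p : ℝ) (q : ℝ) ((p : ℝ) + q + n) (1 : ℝ)) := by
  
  obtain ⟨M, rfl⟩ := Nat.exists_eq_add_of_le' hn
  have hη' : ‖η‖ = 1 := by simpa using hη
  have hsphere : ∀ ξ ∈ Metric.sphere (0 : EuclideanSpace ℂ (Fin (M + 2))) 1, ‖ξ‖ = 1 :=
    fun ξ hξ => by simpa using hξ
  have hP : ∀ ξ ∈ Metric.sphere (0 : EuclideanSpace ℂ (Fin (M + 2))) 1,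
      ComplexSphere.poissonSzego ((r : ℂ) • ξ) η =
        (1 - r ^ 2) ^ (M + 2) / ‖1 - (r : ℂ) * ComplexSphere.herm ξ η‖ ^ (2 * (M + 2)) := by
    intro ξ hξ
    rw [ComplexSphere.poissonSzego, ComplexSphere.herm_smul, norm_smul, hsphere ξ hξ,
      Complex.norm_real, Real.norm_of_nonneg hr0, mul_one]
  have hZ : ∀ ξ ∈ Metric.sphere (0 : EuclideanSpace ℂ (Fin (M + 2))) 1, ∀ p q,
      ‖ComplexSphere.zonalKernel p q η ξ‖ ≤ 1 := fun ξ hξ p q =>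
    ComplexSphere.norm_zonalKernel_le_one M p q hη' (hsphere ξ hξ)
  have hsum : ∀ ξ ∈ Metric.sphere (0 : EuclideanSpace ℂ (Fin (M + 2))) 1, HasSum
      (fun pq : ℕ × ℕ =>
        (Module.finrank ℂ (ComplexSphere.solidHarmonics (M + 2) pq.1 pq.2) : ℂ) *
          (ComplexSphere.szegoCoeff (M + 2) pq.1 pq.2 r : ℂ) *
          ComplexSphere.zonalKernel pq.1 pq.2 η ξ)
      (ComplexSphere.poissonSzego ((r : ℂ) • ξ) η : ℂ) := by
    intro ξ hξ
    have hZξ := hZ ξ hξ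
    simp only [ComplexSphere.zonalKernel_eq] at hZξ ⊢
    rw [hP ξ hξ]
    exact ComplexSphere.hasSum_zonal_expansion M hr0 hr1
      (ComplexSphere.norm_herm_le_one (hsphere ξ hξ) hη') hZξ
  refine ⟨fun ξ hξ => ⟨hP ξ hξ, hsum ξ hξ⟩, ?_, fun p q => ?_, fun p q => ?_, fun p q hp hq => ?_,
    fun p q => ComplexSphere.hypergeometric_form (M + 1) p q r⟩
  -- Weierstrass' test: the majorant does not involve `ξ`, and the limit is identified by the
  -- pointwise sums.
  · exact (HasSumUniformlyOn.of_norm_le_summable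
      (ComplexSphere.summable_choose_mul_pow_mul M hr0 hr1) fun pq ξ hξ =>
        ComplexSphere.norm_term_le M pq.1 pq.2 hr0 hr1 (hZ ξ hξ pq.1 pq.2)).congr_right
      fun ξ hξ => (hsum ξ hξ).tsum_eq
  · exact ⟨ComplexSphere.zonalPoly M p q η, ComplexSphere.zonalPoly_mem_solidHarmonics M p q hη',
      fun ξ hξ => ComplexSphere.zonalKernel_eq_value M p q η ξ (hsphere ξ hξ)⟩
  · exact ComplexSphere.summable_szegoTerm (M + 1) p q hr0 hr1.le
  · simp only [← ComplexSphere.szegoTerm_eq_factorial (M + 2) p q hp hq r]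
    exact (ComplexSphere.summable_szegoTerm (M + 1) p q hr0 hr1.le).hasSum
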